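/- Conventions. Let $U\subset\mathbb C^{n+1}$ be open, $\varrho\colon U\to\mathbb R$ smooth, and $M=\{z\in U:\varrho(z)=0\}$ with $d\varrho\neq 0$ on $M$. Write $\varrho_j=\partial\varrho/\partial z_j$, $\varrho_{\bar k}=\partial\varrho/\partial\bar z_k$, and similarly for higher derivatives, and let $T^{1,0}M=\{Z=\sum_j Z_j\,\partial/\partial z_j : \sum_j\varrho_jZ_j=0\}$ along $M$. Let $\theta=\iota^*(i\bar\partial\varrho)$, where $\iota\colon M\to\mathbb C^{n+1}$ is the inclusion, with Levi metric $\langle Z,\overline W\rangle=-i\,d\theta(Z,\overline W)=\sum_{j,k}\varrho_{j\bar k}Z_j\overline{W_k}$ and $|Z|^2=\langle Z,\overline Z\rangle$. Let $\nabla$ be the Tanaka–Webster connection of $(M,\theta)$, $R(X,Y)=\nabla_X\nabla_Y-\nabla_Y\nabla_X-\nabla_{[X,Y]}$ its curvature, $R_{\alpha\bar\beta\gamma\bar\sigma}=\langle R(Z_\gamma,Z_{\bar\sigma})Z_\alpha,Z_{\bar\beta}\rangle$ in a local frame $(Z_\alpha)$ of $T^{1,0}M$ with Levi matrix $h_{\alpha\bar\beta}=\langle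 Z_\alpha,Z_{\bar\beta}\rangle$ and inverse transpose $h^{\alpha\bar\beta}$. The holomorphic sectional curvature of $0\ne Z=\zeta^\alpha Z_\alpha$ is $K(Z)=\tfrac12R_{\alpha\bar\beta\gamma\bar\sigma}\zeta^\alpha\overline{\zeta^\beta}\zeta^\gamma\overline{\zeta^\sigma}/|Z|^4$, and the scalar curvature is $R=h^{\alpha\bar\beta}h^{\gamma\bar\sigma}R_{\alpha\bar\beta\gamma\bar\sigma}$. Corollary 1.3. Suppose that $a=(a_{j\bar k})$ is a constant positive definite Hermitian matrix such that, for all $j,k$ and all $p\in M$, $\varrho_{j\bar k}(z)=a_{j\bar k}+o(\varrho(z))$ as $z\to p$. Let $|\partial\varrho|^2=\sum_{j,k}a^{j\bar k}\varrho_j\varrho_{\bar k}$, where $(a^{j\bar k})$ is the inverse transpose of $(a_{j\bar k})$. If $M$ is $\mathbb C$-convex, in the sense that $$\operatorname{Re}\sum_{j,k}\varrho_{jk}(p)\eta_j\eta_k+\sum_{j,k}\varrho_{j\bar k}(p)\eta_j\overline{\eta_k}\ \ge\ 0$$ for all $p\in M$ and all $\eta\in\mathbb C^{n+1}$ with $\sum_j\varrho_j(p)\eta_j=0$,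 then at every point of $M$ and for every nonzero $Z\in T^{1,0}M$, $$K(Z)\ \ge\ \tfrac12\,|\partial\varrho|^{-2}.$$ In particular, let $n\ge1$, let $a_j,b_j>0$ $(1\le j\le n+1)$, and consider the real ellipsoid $E=\{\varrho=0\}\subset\mathbb C^{n+1}$ with $\varrho(z)=\sum_j(a_jx_j^2+b_jy_j^2)-1$, $z_j=x_j+iy_j$, and $\theta=\iota^*(i\bar\partial\varrho)$. Then the Tanaka–Webster scalar curvature of $(E,\theta)$ is positive everywhere. -/

import Mathlib

open Topology Asymptotics
open scoped ContDiff ComplexOrder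

noncomputable section

namespace Pseudohermitian

/-! ### Complex vector fields on `ℂⁿ⁺¹` -/

/-- The space `ℂⁿ⁺¹`. -/
abbrev Cn (n : ℕ) : Type := Fin (n + 1) → ℂ

/-- The Wirtinger derivative `∂f/∂z_j` at `p`. -/
def dz {n : ℕ} (f : Cn n → ℂ) (j : Fin (n + 1)) (p : Cn n) : ℂ :=
  (fderiv ℝ f p (Pi.single j 1) - Complex.I * fderiv ℝ f p (Pi.single j Complex.I)) / 2

/-- The Wirtinger derivative `∂f/∂z̄_j` at `p`. -/
def dzbar {n : ℕ} (f : Cn n → ℂ) (j : Fin (n + 1)) (p : Cn n) : ℂ :=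
  (fderiv ℝ f p (Pi.single j 1) + Complex.I * fderiv ℝ f p (Pi.single j Complex.I)) / 2

/-- A complex vector field: the pair `(u, v)` of coefficient functions stands for
`∑ u_j ∂/∂z_j + ∑ v_j ∂/∂z̄_j`. -/
abbrev CField (n : ℕ) : Type := Cn n → Cn n × Cn n

/-- The `(1,0)`-field `∑ Z_j ∂/∂z_j`. -/
def hol {n : ℕ} (Z : Cn n → Cn n) : CField n := fun p => (Z p, 0)

/-- The `(0,1)`-field `∑ W_j ∂/∂z̄_j`. -/
def antihol {n : ℕ} (W : Cn n → Cn n) : CField n := fun p => (0, W p)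

/-- The conjugate `∑ conj(Z_j) ∂/∂z̄_j` of the `(1,0)`-field `∑ Z_j ∂/∂z_j`. -/
def conjField {n : ℕ} (Z : Cn n → Cn n) : CField n := antihol fun p => star (Z p)

/-- The derivative `X f` of a function along a complex vector field. -/
def lieD {n : ℕ} (X : CField n) (f : Cn n → ℂ) (p : Cn n) : ℂ :=
  ∑ j, ((X p).1 j * dz f j p + (X p).2 j * dzbar f j p)

/-- The Lie bracket `[X, Y]` of complex vector fields. -/
def bracket {n : ℕ} (X Y : CField n) : CField n := fun p =>
  (fun k => lieD X (fun q => (Y q).1 k) p - lieD Y (fun q => (X q).1 k) p,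
   fun k => lieD X (fun q => (Y q).2 k) p - lieD Y (fun q => (X q).2 k) p)

/-! ### The pseudohermitian structure `θ = ι^*(i ∂̄ρ)` of a level set of `ρ` -/

/-- `ρ_j = ∂ρ/∂z_j`. -/
def rhoD {n : ℕ} (ρ : Cn n → ℝ) (p : Cn n) : Cn n := fun j => dz (fun z => (ρ z : ℂ)) j p

/-- `ρ_k̄ = ∂ρ/∂z̄_k`. -/
def rhoDbar {n : ℕ} (ρ : Cn n → ℝ) (p : Cn n) : Cn n := fun k => dzbar (fun z => (ρ z : ℂ)) k p

/-- `ρ_{jk} = ∂²ρ/∂z_j∂z_k`. -/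
def rhoDD {n : ℕ} (ρ : Cn n → ℝ) (p : Cn n) : Matrix (Fin (n + 1)) (Fin (n + 1)) ℂ :=
  fun j k => dz (fun q => rhoD ρ q k) j p

/-- The complex Hessian `ρ_{jk̄} = ∂²ρ/∂z_j∂z̄_k`. -/
def leviMat {n : ℕ} (ρ : Cn n → ℝ) (p : Cn n) : Matrix (Fin (n + 1)) (Fin (n + 1)) ℂ :=
  fun j k => dz (fun q => rhoDbar ρ q k) j p

/-- The form `θ = i ∂̄ρ` evaluated on a complex tangent vector. -/
def theta {n : ℕ} (ρ : Cn n → ℝ) (p : Cn n) (X : Cn n × Cn n) : ℂ :=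
  Complex.I * ∑ k, rhoDbar ρ p k * X.2 k

/-- `dθ = i ∂∂̄ρ = i ∑ ρ_{jk̄} dz_j ∧ dz̄_k` evaluated on two complex tangent vectors. -/
def dtheta {n : ℕ} (ρ : Cn n → ℝ) (p : Cn n) (X Y : Cn n × Cn n) : ℂ :=
  Complex.I * ∑ j, ∑ k, leviMat ρ p j k * (X.1 j * Y.2 k - Y.1 j * X.2 k)

/-- The Levi metric `⟨Z, W̄⟩ = -i dθ(Z, W̄)` on `(1,0)`-vectors. -/
def levi {n : ℕ} (ρ : Cn n → ℝ) (p : Cn n) (Z W : Cn n) : ℂ :=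
  -Complex.I * dtheta ρ p (Z, 0) (0, star W)

/-- The vector `φ^♯` with `∑_j ρ_{jk̄} (φ^♯)_j = φ_k`, where `ρ_{jk̄}` is invertible. -/
def sharp {n : ℕ} (ρ : Cn n → ℝ) (p : Cn n) (φ : Cn n) : Cn n :=
  Matrix.vecMul φ (leviMat ρ p)⁻¹

/-- The `(1,0)`-vector `ξ = (∂̄ρ)^♯`; it spans the orthogonal complement of `T^{1,0}`, since
`∑ ρ_{jk̄} ξ_j W̄_k = ∑ ρ_k̄ W̄_k`. -/
def normalVec {n : ℕ} (ρ : Cn n → ℝ) (p : Cn n) : Cn n := sharp ρ p (rhoDbar ρ p)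

/-- The `(1,0)`-part `i ξ / ∂ρ(ξ)` of the Reeb field. -/
def reeb10 {n : ℕ} (ρ : Cn n → ℝ) (p : Cn n) : Cn n :=
  (Complex.I / (rhoD ρ p ⬝ᵥ normalVec ρ p)) • normalVec ρ p

/-- The Reeb field: the real field tangent to the level set with `θ(T) = 1` and `T ⌟ dθ = 0` on
tangent vectors. -/
def reeb {n : ℕ} (ρ : Cn n → ℝ) : CField n := fun p => (reeb10 ρ p, star (reeb10 ρ p))

/-- The component of a tangent field in `T^{1,0}`, in the splitting
`ℂT = T^{1,0} ⊕ T^{0,1} ⊕ ℂ T`. -/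
def proj10 {n : ℕ} (ρ : Cn n → ℝ) (X : CField n) : Cn n → Cn n := fun p =>
  (X p).1 - theta ρ p (X p) • (reeb ρ p).1

/-- The component of a tangent field in `T^{0,1}`, in the same splitting. -/
def proj01 {n : ℕ} (ρ : Cn n → ℝ) (X : CField n) : Cn n → Cn n := fun p =>
  (X p).2 - theta ρ p (X p) • (reeb ρ p).2

/-! ### The Tanaka–Webster connection on `T^{1,0}` and its curvature -/

/-- `∇_X Y` for `(1,0)`-fields `X`, `Y`. It is the section of `T^{1,0}` determined by the
compatibility with the Levi metric,
`⟨∇_X Y, W̄⟩ = X⟨Y, W̄⟩ - ⟨Y, ∇_X W̄⟩` with `∇_X W̄` the `(0,1)`-component of `[X, W̄]`.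
The right-hand side equals `∑_k φ_k W̄_k` with `φ_k = X (∑_j ρ_{jk̄} Y_j)`,
as `⟨Y, ·⟩` kills `T` and the `k`-th antiholomorphic coefficient of `[X, W̄]` is `X W̄_k`;
so `∇_X Y` is the orthogonal projection of `φ^♯` to `T^{1,0}`. -/
def nabla10 {n : ℕ} (ρ : Cn n → ℝ) (X Y : Cn n → Cn n) : Cn n → Cn n := fun p =>
  let V : Cn n := sharp ρ p fun k => lieD (hol X) (fun q => ∑ j, leviMat ρ q j k * Y q j) p
  V - ((rhoD ρ p ⬝ᵥ V) / (rhoD ρ p ⬝ᵥ normalVec ρ p)) • normalVec ρ p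

/-- The Tanaka–Webster covariant derivative `∇_X Y` of a section `Y` of `T^{1,0}` along a complex
tangent field `X = X' + X'' + θ(X) T`, `X'` of type `(1,0)` and `X''` of type `(0,1)`:
`∇_{X'} Y` is fixed by metric compatibility, `∇_{X''} Y` is the `(1,0)`-component of `[X'', Y]`,
and `∇_T Y` is the `(1,0)`-component of `[T, Y]`. These are the structure equations
`dθ^β = θ^α ∧ ω_α^β + A^β_ᾱ θ ∧ θ^ᾱ`, `dh_{αβ̄} = ω_α^γ h_{γβ̄} + h_{αγ̄} ω_β̄^γ̄` solved
for the connection forms. Along the hypersurface only derivatives tangent to it occur. -/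
def nabla {n : ℕ} (ρ : Cn n → ℝ) (X : CField n) (Y : Cn n → Cn n) : Cn n → Cn n := fun p =>
  nabla10 ρ (proj10 ρ X) Y p
    + proj10 ρ (bracket (antihol (proj01 ρ X)) (hol Y)) p
    + theta ρ p (X p) • proj10 ρ (bracket (reeb ρ) (hol Y)) p

/-- The curvature operator `R(X, Y) Z = ∇_X ∇_Y Z - ∇_Y ∇_X Z - ∇_{[X,Y]} Z`. -/
def curv {n : ℕ} (ρ : Cn n → ℝ) (X Y : CField n) (Z : Cn n → Cn n) : Cn n → Cn n := fun p =>
  nabla ρ X (nabla ρ Y Z) p - nabla ρ Y (nabla ρ X Z) p - nabla ρ (bracket X Y) Z p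

/-- The Tanaka–Webster curvature `R_{αβ̄γσ̄} = ⟨R(Z_γ, Z_σ̄) Z_α, Z_β̄⟩` at `p`, for
`(1,0)`-fields `Z_α = A`, `Z_β = B`, `Z_γ = C`, `Z_σ = D`. -/
def curvTensor {n : ℕ} (ρ : Cn n → ℝ) (A B C D : Cn n → Cn n) (p : Cn n) : ℂ :=
  levi ρ p (curv ρ (hol C) (conjField D) A p) (B p)

/-- Webster's holomorphic sectional curvature `K(Z) = ½ R(Z, Z̄, Z, Z̄) / |Z|⁴` at `p`
(a real number). -/
def holSecCurv {n : ℕ} (ρ : Cn n → ℝ) (Z : Cn n → Cn n) (p : Cn n) : ℝ :=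
  (1 / 2) * (curvTensor ρ Z Z Z Z p).re / ((levi ρ p (Z p) (Z p)).re) ^ 2

/-- The Levi matrix `h_{αβ̄} = ⟨Z_α, Z_β̄⟩` of a frame. -/
def frameMat {n : ℕ} (ρ : Cn n → ℝ) (Z : Fin n → Cn n → Cn n) (p : Cn n) :
    Matrix (Fin n) (Fin n) ℂ :=
  fun α β => levi ρ p (Z α p) (Z β p)

/-- The Tanaka–Webster scalar curvature `R = h^{αβ̄} h^{γσ̄} R_{αβ̄γσ̄}` at `p` (a real number),
computed in a frame of `T^{1,0}`; `h^{αβ̄}` is the inverse transpose of the Levi matrix. -/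
def scalarCurv {n : ℕ} (ρ : Cn n → ℝ) (Z : Fin n → Cn n → Cn n) (p : Cn n) : ℝ :=
  (∑ α, ∑ β, ∑ γ, ∑ σ, (frameMat ρ Z p)⁻¹ β α * (frameMat ρ Z p)⁻¹ σ γ *
    curvTensor ρ (Z α) (Z β) (Z γ) (Z σ) p).re

/-! ### Hypersurfaces, sections of `T^{1,0}`, convexity, ellipsoids -/

/-- The hypersurface `{ρ = 0}` in the domain `U` of `ρ`. -/
def zeroSet {n : ℕ} (U : Set (Cn n)) (ρ : Cn n → ℝ) : Set (Cn n) := {p ∈ U | ρ p = 0}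

/-- `Z` is (a smooth extension of) a smooth section near `p` of `T^{1,0}M`, `M = {ρ = 0}`:
the field `∑ Z_j ∂/∂z_j` is tangent to `M` at the points of `M` near `p`. -/
def IsSectionAt {n : ℕ} (ρ : Cn n → ℝ) (Z : Cn n → Cn n) (p : Cn n) : Prop :=
  ContDiffAt ℝ ∞ Z p ∧ ∀ᶠ q in 𝓝 p, ρ q = 0 → rhoD ρ q ⬝ᵥ Z q = 0

/-- `Z_1, …, Z_n` is a local frame of `T^{1,0}M` near `p`. -/
def IsFrameAt {n : ℕ} (ρ : Cn n → ℝ) (Z : Fin n → Cn n → Cn n) (p : Cn n) : Prop :=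
  (∀ α, IsSectionAt ρ (Z α) p) ∧ LinearIndependent ℂ fun α => Z α p

/-- The Hessian `Hess_ρ(p; η) = Re ∑ ρ_{jk} η_j η_k + ∑ ρ_{jk̄} η_j η̄_k`. -/
def hess {n : ℕ} (ρ : Cn n → ℝ) (p η : Cn n) : ℝ :=
  (∑ j, ∑ k, rhoDD ρ p j k * η j * η k).re + (∑ j, ∑ k, leviMat ρ p j k * η j * star (η k)).re

/-- `{ρ = 0}` is `ℂ`-convex: the Hessian of `ρ` is positive semidefinite on the complex tangent
space at every point. -/
def IsCConvex {n : ℕ} (U : Set (Cn n)) (ρ : Cn n → ℝ) : Prop :=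
  ∀ p ∈ zeroSet U ρ, ∀ η : Cn n, rhoD ρ p ⬝ᵥ η = 0 → 0 ≤ hess ρ p η

/-- `|∂ρ|² = ∑ a^{jk̄} ρ_j ρ_k̄`, with `a^{jk̄}` the inverse transpose of `a_{jk̄}`. -/
def normSqD {n : ℕ} (a : Matrix (Fin (n + 1)) (Fin (n + 1)) ℂ) (ρ : Cn n → ℝ) (p : Cn n) : ℝ :=
  (∑ j, ∑ k, a⁻¹ k j * rhoD ρ p j * rhoDbar ρ p k).re

/-- The defining function `∑ (a_j x_j² + b_j y_j²) - 1`, `z_j = x_j + i y_j`, of an ellipsoid. -/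
def ellipsoidFn {n : ℕ} (a b : Fin (n + 1) → ℝ) (z : Cn n) : ℝ :=
  ∑ j, (a j * (z j).re ^ 2 + b j * (z j).im ^ 2) - 1

end Pseudohermitian

end

open Pseudohermitian

/-! Because `ρ_{jk̄} = a_{jk̄} + o(ρ)`, the complex Hessian equals `a` and has vanishing first
derivatives at every point of `M`, so `M` behaves like a hypersurface in a flat Hermitian space. Let
`ξ = (∂̄ρ)^♯`, `ν = ∂ρ(ξ) = |∂ρ|²` and `H = (ρ_{jk})`. On `M` the connection is the componentwise
derivative plus a normal correction: `∇_C Y = C Y + (H(C, Y)/ν) ξ` and `∇_D̄ Y = D̄ Y + (⟨Y, D̄⟩/ν)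
ξ` (`IsLeviFlatAt.nabla_hol_eq`, `IsLeviFlatAt.nabla_conjField_eq`).

On differentiating once more, the componentwise second derivatives cancel against `[C, D̄]`. What
survives comes from the derivatives of `ξ` and from the Reeb component of `[C, D̄]`. This is the
Gauss equation `curvTensor_eq`: `ν R(A, B̄, C, D̄) = ⟨A, D̄⟩⟨C, B̄⟩ + ⟨C, D̄⟩⟨A, B̄⟩ - H(C, A) conj
H(D, B)`.

With all arguments equal to `Z` it gives `K(Z) = (2|Z|⁴ - |H(Z, Z)|²) / (2ν|Z|⁴)`. Rotating `Z` by a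
phase turns `ℂ`-convexity into `|H(Z, Z)| ≤ |Z|²` (`norm_hessForm_le`), whence `K(Z) ≥ 1/(2ν)`.

For an ellipsoid both Hessians are constant and diagonal, with entries `(a_j + b_j)/2` and `(a_j -
b_j)/2`. Contracting the Gauss equation gives `ν R = n + n² - |H|²`, and `trace_hess_le` bounds the
tangential norm by `|H|² ≤ n`, so `ν R ≥ n² > 0`.

Fields are tangent, and the formulas above hold, only on `M`. They may still be differentiated in
tangential directions, by `lieD_congr_of_eqOn_level`. -/

namespace Pseudohermitian

/-! ### Calculus of complex vector fields -/

section Calculus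

variable {n : ℕ}

/-- The complex-linear extension of a real-linear map, evaluated at a complex tangent vector. -/
noncomputable def wirtinger (w : Cn n × Cn n) : (Cn n →L[ℝ] ℂ) →ₗ[ℂ] ℂ where
  toFun A := ∑ j, (w.1 j * ((A (Pi.single j 1) - Complex.I * A (Pi.single j Complex.I)) / 2) +
    w.2 j * ((A (Pi.single j 1) + Complex.I * A (Pi.single j Complex.I)) / 2))
  map_add' A B := by
    rw [← Finset.sum_add_distrib]
    refine Finset.sum_congr rfl fun j _ => ?_
    simp only [add_apply]
    ring
  map_smul' c A := by
    rw [RingHom.id_apply, smul_eq_mul, Finset.mul_sum]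
    refine Finset.sum_congr rfl fun j _ => ?_
    simp only [smul_apply, smul_eq_mul]
    ring

/-- Reduces the rules for `lieD` to those for `fderiv`, by `ℂ`-linearity in the differential. -/
theorem lieD_eq_wirtinger (X : CField n) (f : Cn n → ℂ) (p : Cn n) :
    lieD X f p = wirtinger (X p) (fderiv ℝ f p) := rfl

theorem lieD_congr_field {X Y : CField n} {p : Cn n} (h : X p = Y p) (f : Cn n → ℂ) :
    lieD X f p = lieD Y f p := by
  rw [lieD_eq_wirtinger, lieD_eq_wirtinger, h]

theorem lieD_congr {f g : Cn n → ℂ} {p : Cn n} (h : f =ᶠ[𝓝 p] g) (X : CField n) :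
    lieD X f p = lieD X g p := by
  rw [lieD_eq_wirtinger, lieD_eq_wirtinger, h.fderiv_eq]

theorem lieD_of_fderiv_eq_zero {f : Cn n → ℂ} {p : Cn n} (h : fderiv ℝ f p = 0) (X : CField n) :
    lieD X f p = 0 := by
  rw [lieD_eq_wirtinger, h, map_zero]

theorem lieD_const (X : CField n) (c : ℂ) (p : Cn n) : lieD X (fun _ => c) p = 0 :=
  lieD_of_fderiv_eq_zero (fderiv_const_apply c) X

theorem lieD_of_field_eq_zero {X : CField n} {p : Cn n} (h : X p = 0) (f : Cn n → ℂ) :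
    lieD X f p = 0 := by
  simp [lieD, h]

theorem lieD_add {f g : Cn n → ℂ} {p : Cn n} (X : CField n) (hf : DifferentiableAt ℝ f p)
    (hg : DifferentiableAt ℝ g p) :
    lieD X (fun q => f q + g q) p = lieD X f p + lieD X g p := by
  simp only [lieD_eq_wirtinger]
  rw [fderiv_fun_add hf hg, map_add]

theorem lieD_sub {f g : Cn n → ℂ} {p : Cn n} (X : CField n) (hf : DifferentiableAt ℝ f p)
    (hg : DifferentiableAt ℝ g p) :
    lieD X (fun q => f q - g q) p = lieD X f p - lieD X g p := by
  simp only [lieD_eq_wirtinger]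
  rw [fderiv_fun_sub hf hg, map_sub]

theorem lieD_mul {f g : Cn n → ℂ} {p : Cn n} (X : CField n) (hf : DifferentiableAt ℝ f p)
    (hg : DifferentiableAt ℝ g p) :
    lieD X (fun q => f q * g q) p = lieD X f p * g p + f p * lieD X g p := by
  simp only [lieD_eq_wirtinger]
  rw [fderiv_fun_mul hf hg, map_add, map_smul, map_smul, smul_eq_mul, smul_eq_mul]
  ring

theorem lieD_sum {ι : Type*} {s : Finset ι} {f : ι → Cn n → ℂ} {p : Cn n} (X : CField n)
    (hf : ∀ i ∈ s, DifferentiableAt ℝ (f i) p) :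
    lieD X (fun q => ∑ i ∈ s, f i q) p = ∑ i ∈ s, lieD X (f i) p := by
  simp only [lieD_eq_wirtinger]
  rw [fderiv_fun_sum hf, map_sum]

theorem lieD_hol (Z : Cn n → Cn n) (f : Cn n → ℂ) (p : Cn n) :
    lieD (hol Z) f p = ∑ j, Z p j * dz f j p := by
  simp [lieD, hol]

theorem lieD_antihol (Z : Cn n → Cn n) (f : Cn n → ℂ) (p : Cn n) :
    lieD (antihol Z) f p = ∑ j, Z p j * dzbar f j p := by
  simp [lieD, antihol]

theorem fderiv_star_apply (f : Cn n → ℂ) (p v : Cn n) :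
    fderiv ℝ (fun q => star (f q)) p v = star (fderiv ℝ f p v) := by
  rw [fderiv_star]
  rfl

theorem dzbar_star (f : Cn n → ℂ) (j : Fin (n + 1)) (p : Cn n) :
    dzbar (fun q => star (f q)) j p = star (dz f j p) := by
  rw [dzbar, dz, fderiv_star_apply, fderiv_star_apply]
  simp

theorem lieD_conjField_star (Z : Cn n → Cn n) (f : Cn n → ℂ) (p : Cn n) :
    lieD (conjField Z) (fun q => star (f q)) p = star (lieD (hol Z) f p) := by
  rw [conjField, lieD_antihol, lieD_hol, star_sum]
  refine Finset.sum_congr rfl fun j _ => ?_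
  rw [dzbar_star, star_mul', Pi.star_apply]

theorem rhoDbar_eq_star (ρ : Cn n → ℝ) (p : Cn n) : rhoDbar ρ p = star (rhoD ρ p) := by
  funext k
  rw [Pi.star_apply, rhoD, ← dzbar_star, rhoDbar]
  simp

/-! ### Smoothness -/

theorem contDiffAt_dz {f : Cn n → ℂ} {p : Cn n} (hf : ContDiffAt ℝ ∞ f p) (j : Fin (n + 1)) :
    ContDiffAt ℝ ∞ (dz f j) p := by
  have h : ContDiffAt ℝ ∞ (fderiv ℝ f) p := hf.fderiv_right (by simp)
  have h1 (v : Cn n) : ContDiffAt ℝ ∞ (fun q => fderiv ℝ f q v) p := h.clm_apply contDiffAt_const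
  exact ((h1 _).sub (contDiffAt_const.mul (h1 _))).div_const 2

theorem contDiffAt_dzbar {f : Cn n → ℂ} {p : Cn n} (hf : ContDiffAt ℝ ∞ f p) (j : Fin (n + 1)) :
    ContDiffAt ℝ ∞ (dzbar f j) p := by
  have h : ContDiffAt ℝ ∞ (fderiv ℝ f) p := hf.fderiv_right (by simp)
  have h1 (v : Cn n) : ContDiffAt ℝ ∞ (fun q => fderiv ℝ f q v) p := h.clm_apply contDiffAt_const
  exact ((h1 _).add (contDiffAt_const.mul (h1 _))).div_const 2

theorem contDiffAt_lieD {X : CField n} {f : Cn n → ℂ} {p : Cn n} (hX : ContDiffAt ℝ ∞ X p)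
    (hf : ContDiffAt ℝ ∞ f p) : ContDiffAt ℝ ∞ (lieD X f) p := by
  have h1 := contDiffAt_pi.1 hX.fst
  have h2 := contDiffAt_pi.1 hX.snd
  exact ContDiffAt.sum fun j _ =>
    ((h1 j).mul (contDiffAt_dz hf j)).add ((h2 j).mul (contDiffAt_dzbar hf j))

theorem contDiffAt_star {E : Type*} [NormedAddCommGroup E] [NormedSpace ℝ E] {m : ℕ∞}
    {f : E → ℂ} {p : E} (hf : ContDiffAt ℝ m f p) : ContDiffAt ℝ m (fun q => star (f q)) p :=
  Complex.conjCLE.contDiff.contDiffAt.comp p hf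

theorem contDiffAt_star_pi {Z : Cn n → Cn n} {p : Cn n} (hZ : ContDiffAt ℝ ∞ Z p) :
    ContDiffAt ℝ ∞ (fun q => star (Z q)) p :=
  contDiffAt_pi.2 fun j => contDiffAt_star (contDiffAt_pi.1 hZ j)

theorem contDiffAt_hol {Z : Cn n → Cn n} {p : Cn n} (hZ : ContDiffAt ℝ ∞ Z p) :
    ContDiffAt ℝ ∞ (hol Z) p :=
  hZ.prodMk contDiffAt_const

theorem contDiffAt_antihol {Z : Cn n → Cn n} {p : Cn n} (hZ : ContDiffAt ℝ ∞ Z p) :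
    ContDiffAt ℝ ∞ (antihol Z) p :=
  contDiffAt_const.prodMk hZ

theorem contDiffAt_conjField {Z : Cn n → Cn n} {p : Cn n} (hZ : ContDiffAt ℝ ∞ Z p) :
    ContDiffAt ℝ ∞ (conjField Z) p :=
  contDiffAt_antihol (contDiffAt_star_pi hZ)

theorem contDiffAt_bracket {X Y : CField n} {p : Cn n} (hX : ContDiffAt ℝ ∞ X p)
    (hY : ContDiffAt ℝ ∞ Y p) : ContDiffAt ℝ ∞ (bracket X Y) p :=
  (contDiffAt_pi.2 fun k =>
    (contDiffAt_lieD hX (contDiffAt_pi.1 hY.fst k)).sub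
      (contDiffAt_lieD hY (contDiffAt_pi.1 hX.fst k))).prodMk
  (contDiffAt_pi.2 fun k =>
    (contDiffAt_lieD hX (contDiffAt_pi.1 hY.snd k)).sub
      (contDiffAt_lieD hY (contDiffAt_pi.1 hX.snd k)))

theorem contDiffAt_ofReal {ρ : Cn n → ℝ} {p : Cn n} (hρ : ContDiffAt ℝ ∞ ρ p) :
    ContDiffAt ℝ ∞ (fun z => (ρ z : ℂ)) p :=
  Complex.ofRealCLM.contDiff.contDiffAt.comp p hρ

theorem contDiffAt_rhoD {ρ : Cn n → ℝ} {p : Cn n} (hρ : ContDiffAt ℝ ∞ ρ p) :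
    ContDiffAt ℝ ∞ (rhoD ρ) p :=
  contDiffAt_pi.2 fun j => contDiffAt_dz (contDiffAt_ofReal hρ) j

theorem contDiffAt_rhoDbar {ρ : Cn n → ℝ} {p : Cn n} (hρ : ContDiffAt ℝ ∞ ρ p) :
    ContDiffAt ℝ ∞ (rhoDbar ρ) p :=
  contDiffAt_pi.2 fun j => contDiffAt_dzbar (contDiffAt_ofReal hρ) j

theorem contDiffAt_rhoDD {ρ : Cn n → ℝ} {p : Cn n} (hρ : ContDiffAt ℝ ∞ ρ p) (j k : Fin (n + 1)) :
    ContDiffAt ℝ ∞ (fun q => rhoDD ρ q j k) p :=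
  contDiffAt_dz (contDiffAt_pi.1 (contDiffAt_rhoD hρ) k) j

theorem contDiffAt_leviMat {ρ : Cn n → ℝ} {p : Cn n} (hρ : ContDiffAt ℝ ∞ ρ p)
    (j k : Fin (n + 1)) : ContDiffAt ℝ ∞ (fun q => leviMat ρ q j k) p :=
  contDiffAt_dz (contDiffAt_pi.1 (contDiffAt_rhoDbar hρ) k) j

theorem contDiffAt_matrix_det {E ι : Type*} [NormedAddCommGroup E] [NormedSpace ℝ E] [Fintype ι]
    [DecidableEq ι] {A : E → Matrix ι ι ℂ} {p : E}
    (hA : ∀ i j, ContDiffAt ℝ ∞ (fun q => A q i j) p) :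
    ContDiffAt ℝ ∞ (fun q => (A q).det) p := by
  simp only [Matrix.det_apply']
  exact ContDiffAt.sum fun σ _ => contDiffAt_const.mul (contDiffAt_prod fun i _ => hA _ _)

theorem contDiffAt_matrix_inv {E ι : Type*} [NormedAddCommGroup E] [NormedSpace ℝ E] [Fintype ι]
    [DecidableEq ι] {A : E → Matrix ι ι ℂ} {p : E}
    (hA : ∀ i j, ContDiffAt ℝ ∞ (fun q => A q i j) p) (hdet : (A p).det ≠ 0) (i j : ι) :
    ContDiffAt ℝ ∞ (fun q => (A q)⁻¹ i j) p := by
  have h : ContDiffAt ℝ ∞ (fun q => (A q).adjugate i j) p := by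
    simp only [Matrix.adjugate_apply]
    refine contDiffAt_matrix_det fun k l => ?_
    by_cases hk : k = j
    · simp only [Matrix.updateRow_apply, hk, if_true]
      exact contDiffAt_const
    · simp only [Matrix.updateRow_apply, hk, if_false]
      exact hA k l
  simp only [Matrix.inv_def, Matrix.smul_apply, Ring.inverse_eq_inv', smul_eq_mul]
  exact ((contDiffAt_matrix_det hA).inv hdet).mul h

/-! ### Second derivatives -/

theorem fderiv_fderiv_apply {f : Cn n → ℂ} {p : Cn n} (hf : ContDiffAt ℝ 2 f p) (u v : Cn n) :
    fderiv ℝ (fun q => fderiv ℝ f q u) p v = fderiv ℝ (fderiv ℝ f) p v u := by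
  have h : DifferentiableAt ℝ (fderiv ℝ f) p :=
    (hf.fderiv_right (m := 1) (by norm_num)).differentiableAt (by norm_num)
  rw [fderiv_clm_apply h (differentiableAt_const u)]
  simp

theorem fderiv_dz_apply {f : Cn n → ℂ} {p : Cn n} (hf : ContDiffAt ℝ 2 f p) (j : Fin (n + 1))
    (v : Cn n) : fderiv ℝ (dz f j) p v = (fderiv ℝ (fderiv ℝ f) p v (Pi.single j 1) -
      Complex.I * fderiv ℝ (fderiv ℝ f) p v (Pi.single j Complex.I)) / 2 := by
  have h : DifferentiableAt ℝ (fderiv ℝ f) p :=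
    (hf.fderiv_right (m := 1) (by norm_num)).differentiableAt (by norm_num)
  have h1 (u : Cn n) : HasFDerivAt (fun q => fderiv ℝ f q u)
      (fderiv ℝ (fun q => fderiv ℝ f q u) p) p :=
    (h.clm_apply (differentiableAt_const u)).hasFDerivAt
  have h2 := ((h1 (Pi.single j 1)).fun_sub
    ((h1 (Pi.single j Complex.I)).const_mul Complex.I)).mul_const (2⁻¹ : ℂ)
  have h3 : dz f j = fun q => (fderiv ℝ f q (Pi.single j 1) -
      Complex.I * fderiv ℝ f q (Pi.single j Complex.I)) * 2⁻¹ := by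
    funext q; rw [dz, div_eq_mul_inv]
  rw [h3, HasFDerivAt.fderiv h2]
  simp [fderiv_fderiv_apply hf, div_eq_mul_inv, mul_comm]

theorem fderiv_dzbar_apply {f : Cn n → ℂ} {p : Cn n} (hf : ContDiffAt ℝ 2 f p) (j : Fin (n + 1))
    (v : Cn n) : fderiv ℝ (dzbar f j) p v = (fderiv ℝ (fderiv ℝ f) p v (Pi.single j 1) +
      Complex.I * fderiv ℝ (fderiv ℝ f) p v (Pi.single j Complex.I)) / 2 := by
  have h : DifferentiableAt ℝ (fderiv ℝ f) p :=
    (hf.fderiv_right (m := 1) (by norm_num)).differentiableAt (by norm_num)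
  have h1 (u : Cn n) : HasFDerivAt (fun q => fderiv ℝ f q u)
      (fderiv ℝ (fun q => fderiv ℝ f q u) p) p :=
    (h.clm_apply (differentiableAt_const u)).hasFDerivAt
  have h2 := ((h1 (Pi.single j 1)).fun_add
    ((h1 (Pi.single j Complex.I)).const_mul Complex.I)).mul_const (2⁻¹ : ℂ)
  have h3 : dzbar f j = fun q => (fderiv ℝ f q (Pi.single j 1) +
      Complex.I * fderiv ℝ f q (Pi.single j Complex.I)) * 2⁻¹ := by
    funext q; rw [dzbar, div_eq_mul_inv]
  rw [h3, HasFDerivAt.fderiv h2]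
  simp [fderiv_fderiv_apply hf, div_eq_mul_inv, mul_comm, mul_add]

theorem isSymmSndFDerivAt_of_contDiffAt_two {f : Cn n → ℂ} {p : Cn n} (hf : ContDiffAt ℝ 2 f p)
    (u v : Cn n) : fderiv ℝ (fderiv ℝ f) p u v = fderiv ℝ (fderiv ℝ f) p v u :=
  (hf.isSymmSndFDerivAt (by simp)) u v

theorem dz_dz_comm {f : Cn n → ℂ} {p : Cn n} (hf : ContDiffAt ℝ 2 f p) (j k : Fin (n + 1)) :
    dz (dz f k) j p = dz (dz f j) k p := by
  rw [dz, dz, fderiv_dz_apply hf, fderiv_dz_apply hf, fderiv_dz_apply hf, fderiv_dz_apply hf]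
  have h := isSymmSndFDerivAt_of_contDiffAt_two hf
  rw [h (Pi.single k 1) (Pi.single j 1), h (Pi.single k 1) (Pi.single j Complex.I),
    h (Pi.single k Complex.I) (Pi.single j 1), h (Pi.single k Complex.I) (Pi.single j Complex.I)]
  ring

theorem dzbar_dzbar_comm {f : Cn n → ℂ} {p : Cn n} (hf : ContDiffAt ℝ 2 f p) (j k : Fin (n + 1)) :
    dzbar (dzbar f k) j p = dzbar (dzbar f j) k p := by
  rw [dzbar, dzbar, fderiv_dzbar_apply hf, fderiv_dzbar_apply hf, fderiv_dzbar_apply hf,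
    fderiv_dzbar_apply hf]
  have h := isSymmSndFDerivAt_of_contDiffAt_two hf
  rw [h (Pi.single k 1) (Pi.single j 1), h (Pi.single k 1) (Pi.single j Complex.I),
    h (Pi.single k Complex.I) (Pi.single j 1), h (Pi.single k Complex.I) (Pi.single j Complex.I)]
  ring

theorem dz_dzbar_comm {f : Cn n → ℂ} {p : Cn n} (hf : ContDiffAt ℝ 2 f p) (j k : Fin (n + 1)) :
    dz (dzbar f k) j p = dzbar (dz f j) k p := by
  rw [dz, dzbar, fderiv_dzbar_apply hf, fderiv_dzbar_apply hf, fderiv_dz_apply hf,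
    fderiv_dz_apply hf]
  have h := isSymmSndFDerivAt_of_contDiffAt_two hf
  rw [h (Pi.single k 1) (Pi.single j 1), h (Pi.single k 1) (Pi.single j Complex.I),
    h (Pi.single k Complex.I) (Pi.single j 1), h (Pi.single k Complex.I) (Pi.single j Complex.I)]
  ring

theorem lieD_lieD {X Y : CField n} {f : Cn n → ℂ} {p : Cn n} (hY : DifferentiableAt ℝ Y p)
    (hf : ContDiffAt ℝ ∞ f p) :
    lieD X (lieD Y f) p =
      ∑ k, (lieD X (fun q => (Y q).1 k) p * dz f k p + lieD X (fun q => (Y q).2 k) p * dzbar f k p) +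
      ∑ k, ((Y p).1 k * lieD X (dz f k) p + (Y p).2 k * lieD X (dzbar f k) p) := by
  have h1 := differentiableAt_pi.1 hY.fst
  have h2 := differentiableAt_pi.1 hY.snd
  have h3 (k) := (contDiffAt_dz hf k).differentiableAt (by simp)
  have h4 (k) := (contDiffAt_dzbar hf k).differentiableAt (by simp)
  have : lieD Y f = fun q => ∑ j, ((Y q).1 j * dz f j q + (Y q).2 j * dzbar f j q) := rfl
  rw [this, lieD_sum X fun k _ =>
    ((h1 k).fun_mul (h3 k)).fun_add ((h2 k).fun_mul (h4 k)),
    ← Finset.sum_add_distrib]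
  refine Finset.sum_congr rfl fun k _ => ?_
  rw [lieD_add X ((h1 k).fun_mul (h3 k)) ((h2 k).fun_mul (h4 k)), lieD_mul X (h1 k) (h3 k),
    lieD_mul X (h2 k) (h4 k)]
  ring

theorem lieD_bracket {X Y : CField n} {f : Cn n → ℂ} {p : Cn n} (hX : DifferentiableAt ℝ X p)
    (hY : DifferentiableAt ℝ Y p) (hf : ContDiffAt ℝ ∞ f p) :
    lieD (bracket X Y) f p = lieD X (lieD Y f) p - lieD Y (lieD X f) p := by
  have hf2 : ContDiffAt ℝ 2 f p := contDiffAt_infty.1 hf 2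
  -- The second-order parts of `XYf` and `YXf` agree by symmetry of second derivatives, so only
  -- derivatives of the coefficients remain.
  have hs : ∑ k, ((Y p).1 k * lieD X (dz f k) p + (Y p).2 k * lieD X (dzbar f k) p) =
      ∑ k, ((X p).1 k * lieD Y (dz f k) p + (X p).2 k * lieD Y (dzbar f k) p) := by
    simp only [lieD, Finset.mul_sum, ← Finset.sum_add_distrib]
    rw [Finset.sum_comm]
    refine Finset.sum_congr rfl fun j _ => Finset.sum_congr rfl fun k _ => ?_
    rw [dz_dz_comm hf2 j k, dzbar_dzbar_comm hf2 j k, dz_dzbar_comm hf2 j k,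
      ← dz_dzbar_comm hf2 k j]
    ring
  rw [lieD_lieD hY hf, lieD_lieD hX hf, hs, add_sub_add_right_eq_sub, ← Finset.sum_sub_distrib]
  refine Finset.sum_congr rfl fun k _ => ?_
  rw [bracket]
  ring

/-! ### Derivatives along directions tangent to a level set -/

/-- Lagrange multipliers: `φ` is constant on the level set near `q`, so `q` is a constrained
extremum. The multiplier of `dφ` is nonzero because `dρ ≠ 0`. -/
theorem exists_fderiv_eq_smul_of_vanish {ρ φ : Cn n → ℝ} {q : Cn n} (hρ : ContDiffAt ℝ 1 ρ q)
    (hd : fderiv ℝ ρ q ≠ 0) (h0 : ρ q = 0) (hφ : ContDiffAt ℝ 1 φ q)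
    (hv : ∀ᶠ z in 𝓝 q, ρ z = 0 → φ z = 0) : ∃ c : ℝ, fderiv ℝ φ q = c • fderiv ℝ ρ q := by
  have hext : IsLocalExtrOn φ {z | ρ z = ρ q} q := by
    refine Or.inl ?_
    rw [IsMinFilter, eventually_nhdsWithin_iff]
    filter_upwards [hv] with z hz hzq
    rw [hz (hzq.trans h0), hv.self_of_nhds h0]
  obtain ⟨a, b, hab, h⟩ := hext.exists_multipliers_of_hasStrictFDerivAt_1d
    (hρ.hasStrictFDerivAt (by norm_num)) (hφ.hasStrictFDerivAt (by norm_num))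
  have hb : b ≠ 0 := by
    rintro rfl
    have ha : a ≠ 0 := by
      rintro rfl
      exact hab rfl
    rw [zero_smul, add_zero, smul_eq_zero] at h
    exact h.elim ha hd
  refine ⟨-(b⁻¹ * a), ?_⟩
  have h2 : b • fderiv ℝ φ q = -(a • fderiv ℝ ρ q) := by
    exact eq_neg_of_add_eq_zero_right h
  rw [← inv_smul_smul₀ hb (fderiv ℝ φ q), h2, smul_neg, smul_smul]
  exact (neg_smul _ _).symm

theorem lieD_ofReal (ρ : Cn n → ℝ) (X : CField n) (q : Cn n) :
    lieD X (fun z => (ρ z : ℂ)) q = rhoD ρ q ⬝ᵥ (X q).1 + rhoDbar ρ q ⬝ᵥ (X q).2 := by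
  simp only [lieD, dotProduct, ← Finset.sum_add_distrib]
  exact Finset.sum_congr rfl fun j _ => by rw [rhoD, rhoDbar]; ring

theorem lieD_ofReal_eq_zero_of_vanish {ρ φ : Cn n → ℝ} {q : Cn n} (hρ : ContDiffAt ℝ 1 ρ q)
    (hd : fderiv ℝ ρ q ≠ 0) (h0 : ρ q = 0) (hφ : ContDiffAt ℝ 1 φ q)
    (hv : ∀ᶠ z in 𝓝 q, ρ z = 0 → φ z = 0) {X : CField n}
    (hX : rhoD ρ q ⬝ᵥ (X q).1 + rhoDbar ρ q ⬝ᵥ (X q).2 = 0) :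
    lieD X (fun z => (φ z : ℂ)) q = 0 := by
  obtain ⟨c, hc⟩ := exists_fderiv_eq_smul_of_vanish hρ hd h0 hφ hv
  have h1 {ψ : Cn n → ℝ} (hψ : ContDiffAt ℝ 1 ψ q) :
      fderiv ℝ (fun z => (ψ z : ℂ)) q = Complex.ofRealCLM.comp (fderiv ℝ ψ q) :=
    (Complex.ofRealCLM.hasFDerivAt.comp q
      (hψ.differentiableAt (by norm_num)).hasFDerivAt).fderiv
  have h2 : fderiv ℝ (fun z => (φ z : ℂ)) q = (c : ℂ) • fderiv ℝ (fun z => (ρ z : ℂ)) q := by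
    rw [h1 hφ, h1 hρ, hc]
    ext v
    simp
  rw [← lieD_ofReal] at hX
  rw [lieD_eq_wirtinger, h2, map_smul, ← lieD_eq_wirtinger, hX, smul_zero]

/-- The multiplier argument is for real functions, hence the split into real and imaginary parts.
The condition `hX` says `Xρ = 0`, that is, `X` is a complex tangent vector of the level set. -/
theorem lieD_eq_zero_of_vanish {ρ : Cn n → ℝ} {f : Cn n → ℂ} {q : Cn n} (hρ : ContDiffAt ℝ 1 ρ q)
    (hd : fderiv ℝ ρ q ≠ 0) (h0 : ρ q = 0) (hf : ContDiffAt ℝ 1 f q)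
    (hv : ∀ᶠ z in 𝓝 q, ρ z = 0 → f z = 0) {X : CField n}
    (hX : rhoD ρ q ⬝ᵥ (X q).1 + rhoDbar ρ q ⬝ᵥ (X q).2 = 0) : lieD X f q = 0 := by
  have hre : ContDiffAt ℝ 1 (fun z => (f z).re) q :=
    Complex.reCLM.contDiff.contDiffAt.comp q hf
  have him : ContDiffAt ℝ 1 (fun z => (f z).im) q :=
    Complex.imCLM.contDiff.contDiffAt.comp q hf
  have h1 := lieD_ofReal_eq_zero_of_vanish hρ hd h0 hre (hv.mono fun z hz h => by simp [hz h]) hX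
  have h2 := lieD_ofReal_eq_zero_of_vanish hρ hd h0 him (hv.mono fun z hz h => by simp [hz h]) hX
  have h3 : f = fun z => ((f z).re : ℂ) + ((f z).im : ℂ) * Complex.I :=
    funext fun z => (Complex.re_add_im (f z)).symm
  have h4 {ψ : Cn n → ℝ} (hψ : ContDiffAt ℝ 1 ψ q) :
      DifferentiableAt ℝ (fun z => (ψ z : ℂ)) q :=
    Complex.ofRealCLM.differentiableAt.comp q (hψ.differentiableAt (by norm_num))
  rw [h3, lieD_add X (h4 hre) ((h4 him).mul_const Complex.I),
    lieD_mul X (h4 him) (differentiableAt_const _), h1, h2, lieD_const]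
  simp

theorem lieD_congr_of_eqOn_level {ρ : Cn n → ℝ} {f g : Cn n → ℂ} {q : Cn n}
    (hρ : ContDiffAt ℝ 1 ρ q) (hd : fderiv ℝ ρ q ≠ 0) (h0 : ρ q = 0) (hf : ContDiffAt ℝ 1 f q)
    (hg : ContDiffAt ℝ 1 g q) (hv : ∀ᶠ z in 𝓝 q, ρ z = 0 → f z = g z) {X : CField n}
    (hX : rhoD ρ q ⬝ᵥ (X q).1 + rhoDbar ρ q ⬝ᵥ (X q).2 = 0) : lieD X f q = lieD X g q := by
  rw [← sub_eq_zero, ← lieD_sub X (hf.differentiableAt (by norm_num))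
    (hg.differentiableAt (by norm_num))]
  exact lieD_eq_zero_of_vanish hρ hd h0 (hf.sub hg) (hv.mono fun z hz h => by
    rw [hz h, sub_self]) hX

end Calculus

section Connection

variable {n : ℕ} {ρ : Cn n → ℝ} {p q : Cn n}

/-! ### Smoothness of the connection -/

theorem contDiffAt_dotProduct {E ι : Type*} [NormedAddCommGroup E] [NormedSpace ℝ E] [Fintype ι]
    {m : ℕ∞} {u v : E → ι → ℂ} {x : E} (hu : ContDiffAt ℝ m u x) (hv : ContDiffAt ℝ m v x) :
    ContDiffAt ℝ m (fun y => u y ⬝ᵥ v y) x :=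
  ContDiffAt.sum fun i _ => (contDiffAt_pi.1 hu i).mul (contDiffAt_pi.1 hv i)

theorem contDiffAt_complex_div {E : Type*} [NormedAddCommGroup E] [NormedSpace ℝ E] {m : ℕ∞}
    {f g : E → ℂ} {x : E} (hf : ContDiffAt ℝ m f x) (hg : ContDiffAt ℝ m g x) (h0 : g x ≠ 0) :
    ContDiffAt ℝ m (fun y => f y / g y) x := by
  simp only [div_eq_mul_inv]
  exact hf.mul (hg.inv h0)

theorem contDiffAt_sharp {φ : Cn n → Cn n} (hρ : ContDiffAt ℝ ∞ ρ p)
    (hdet : (leviMat ρ p).det ≠ 0) (hφ : ContDiffAt ℝ ∞ φ p) :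
    ContDiffAt ℝ ∞ (fun z => sharp ρ z (φ z)) p :=
  contDiffAt_pi.2 fun j => contDiffAt_dotProduct hφ
    (contDiffAt_pi.2 fun k => contDiffAt_matrix_inv (contDiffAt_leviMat hρ) hdet k j)

theorem contDiffAt_normalVec (hρ : ContDiffAt ℝ ∞ ρ p) (hdet : (leviMat ρ p).det ≠ 0) :
    ContDiffAt ℝ ∞ (normalVec ρ) p :=
  contDiffAt_sharp hρ hdet (contDiffAt_rhoDbar hρ)

/-- The squared length `∂ρ(ξ) = |∂ρ|²` of `ξ` with respect to the complex Hessian. -/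
noncomputable def normalNorm (ρ : Cn n → ℝ) (q : Cn n) : ℂ := rhoD ρ q ⬝ᵥ normalVec ρ q

theorem contDiffAt_normalNorm (hρ : ContDiffAt ℝ ∞ ρ p) (hdet : (leviMat ρ p).det ≠ 0) :
    ContDiffAt ℝ ∞ (normalNorm ρ) p :=
  contDiffAt_dotProduct (contDiffAt_rhoD hρ) (contDiffAt_normalVec hρ hdet)

theorem contDiffAt_reeb10 (hρ : ContDiffAt ℝ ∞ ρ p) (hdet : (leviMat ρ p).det ≠ 0)
    (hν : normalNorm ρ p ≠ 0) : ContDiffAt ℝ ∞ (reeb10 ρ) p :=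
  (contDiffAt_complex_div contDiffAt_const (contDiffAt_normalNorm hρ hdet) hν).smul
    (contDiffAt_normalVec hρ hdet)

theorem contDiffAt_reeb (hρ : ContDiffAt ℝ ∞ ρ p) (hdet : (leviMat ρ p).det ≠ 0)
    (hν : normalNorm ρ p ≠ 0) : ContDiffAt ℝ ∞ (reeb ρ) p :=
  (contDiffAt_reeb10 hρ hdet hν).prodMk (contDiffAt_star_pi (contDiffAt_reeb10 hρ hdet hν))

theorem contDiffAt_theta {X : CField n} (hρ : ContDiffAt ℝ ∞ ρ p) (hX : ContDiffAt ℝ ∞ X p) :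
    ContDiffAt ℝ ∞ (fun z => theta ρ z (X z)) p :=
  contDiffAt_const.mul (contDiffAt_dotProduct (contDiffAt_rhoDbar hρ) hX.snd)

theorem contDiffAt_proj10 {X : CField n} (hρ : ContDiffAt ℝ ∞ ρ p) (hdet : (leviMat ρ p).det ≠ 0)
    (hν : normalNorm ρ p ≠ 0) (hX : ContDiffAt ℝ ∞ X p) : ContDiffAt ℝ ∞ (proj10 ρ X) p :=
  hX.fst.sub ((contDiffAt_theta hρ hX).smul (contDiffAt_reeb hρ hdet hν).fst)

theorem contDiffAt_proj01 {X : CField n} (hρ : ContDiffAt ℝ ∞ ρ p) (hdet : (leviMat ρ p).det ≠ 0)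
    (hν : normalNorm ρ p ≠ 0) (hX : ContDiffAt ℝ ∞ X p) : ContDiffAt ℝ ∞ (proj01 ρ X) p :=
  hX.snd.sub ((contDiffAt_theta hρ hX).smul (contDiffAt_reeb hρ hdet hν).snd)

theorem contDiffAt_nabla10 {X Y : Cn n → Cn n} (hρ : ContDiffAt ℝ ∞ ρ p)
    (hdet : (leviMat ρ p).det ≠ 0) (hν : normalNorm ρ p ≠ 0) (hX : ContDiffAt ℝ ∞ X p)
    (hY : ContDiffAt ℝ ∞ Y p) : ContDiffAt ℝ ∞ (nabla10 ρ X Y) p := by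
  have hV : ContDiffAt ℝ ∞ (fun z => sharp ρ z fun k =>
      lieD (hol X) (fun q => ∑ j, leviMat ρ q j k * Y q j) z) p :=
    contDiffAt_sharp hρ hdet (contDiffAt_pi.2 fun k => contDiffAt_lieD (contDiffAt_hol hX)
      (ContDiffAt.sum fun j _ => (contDiffAt_leviMat hρ j k).mul (contDiffAt_pi.1 hY j)))
  exact hV.sub ((contDiffAt_complex_div (contDiffAt_dotProduct (contDiffAt_rhoD hρ) hV)
    (contDiffAt_normalNorm hρ hdet) hν).smul (contDiffAt_normalVec hρ hdet))

theorem contDiffAt_nabla {X : CField n} {Y : Cn n → Cn n} (hρ : ContDiffAt ℝ ∞ ρ p)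
    (hdet : (leviMat ρ p).det ≠ 0) (hν : normalNorm ρ p ≠ 0) (hX : ContDiffAt ℝ ∞ X p)
    (hY : ContDiffAt ℝ ∞ Y p) : ContDiffAt ℝ ∞ (nabla ρ X Y) p :=
  ((contDiffAt_nabla10 hρ hdet hν (contDiffAt_proj10 hρ hdet hν hX) hY).add
    (contDiffAt_proj10 hρ hdet hν (contDiffAt_bracket
      (contDiffAt_antihol (contDiffAt_proj01 hρ hdet hν hX)) (contDiffAt_hol hY)))).add
    ((contDiffAt_theta hρ hX).smul (contDiffAt_proj10 hρ hdet hν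
      (contDiffAt_bracket (contDiffAt_reeb hρ hdet hν) (contDiffAt_hol hY))))

/-! ### The Levi metric -/

theorem levi_eq (ρ : Cn n → ℝ) (q Z W : Cn n) :
    levi ρ q Z W = Matrix.vecMul Z (leviMat ρ q) ⬝ᵥ star W := by
  simp only [levi, dtheta, Matrix.vecMul, dotProduct, Pi.zero_apply, mul_zero, sub_zero,
    Finset.sum_mul, ← mul_assoc, neg_mul, Complex.I_mul_I, neg_neg, one_mul]
  rw [Finset.sum_comm]
  exact Finset.sum_congr rfl fun k _ => Finset.sum_congr rfl fun j _ => by ring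

theorem levi_add_left (ρ : Cn n → ℝ) (q Z Z' W : Cn n) :
    levi ρ q (Z + Z') W = levi ρ q Z W + levi ρ q Z' W := by
  rw [levi_eq, levi_eq, levi_eq, Matrix.add_vecMul, add_dotProduct]

theorem levi_sub_left (ρ : Cn n → ℝ) (q Z Z' W : Cn n) :
    levi ρ q (Z - Z') W = levi ρ q Z W - levi ρ q Z' W := by
  rw [levi_eq, levi_eq, levi_eq, Matrix.sub_vecMul, sub_dotProduct]

theorem levi_smul_left (ρ : Cn n → ℝ) (q : Cn n) (c : ℂ) (Z W : Cn n) :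
    levi ρ q (c • Z) W = c * levi ρ q Z W := by
  rw [levi_eq, levi_eq, Matrix.smul_vecMul, smul_dotProduct, smul_eq_mul]

theorem vecMul_normalVec (hdet : (leviMat ρ q).det ≠ 0) :
    Matrix.vecMul (normalVec ρ q) (leviMat ρ q) = rhoDbar ρ q := by
  rw [normalVec, sharp, Matrix.vecMul_vecMul, Matrix.nonsing_inv_mul _ (isUnit_iff_ne_zero.2 hdet),
    Matrix.vecMul_one]

theorem sharp_vecMul (hdet : (leviMat ρ q).det ≠ 0) (Z : Cn n) :
    sharp ρ q (Matrix.vecMul Z (leviMat ρ q)) = Z := by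
  rw [sharp, Matrix.vecMul_vecMul, Matrix.mul_nonsing_inv _ (isUnit_iff_ne_zero.2 hdet),
    Matrix.vecMul_one]

theorem rhoDbar_dotProduct_star (ρ : Cn n → ℝ) (q Z : Cn n) :
    rhoDbar ρ q ⬝ᵥ star Z = star (rhoD ρ q ⬝ᵥ Z) := by
  rw [rhoDbar_eq_star, ← Matrix.star_dotProduct_star, dotProduct_comm]

theorem levi_normalVec (hdet : (leviMat ρ q).det ≠ 0) {W : Cn n} (hW : rhoD ρ q ⬝ᵥ W = 0) :
    levi ρ q (normalVec ρ q) W = 0 := by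
  rw [levi_eq, vecMul_normalVec hdet, rhoDbar_dotProduct_star, hW, star_zero]

/-- The derivative of a vector-valued function along a complex vector field. -/
noncomputable def lieV (X : CField n) (Y : Cn n → Cn n) (q : Cn n) : Cn n :=
  fun k => lieD X (fun z => Y z k) q

/-- The symmetric form `∑ ρ_{jk} Z_j W_k`. -/
noncomputable def hessForm (ρ : Cn n → ℝ) (q Z W : Cn n) : ℂ := Z ⬝ᵥ (rhoDD ρ q).mulVec W

theorem lieV_congr_field {X Y : CField n} (h : X q = Y q) (Z : Cn n → Cn n) :
    lieV X Z q = lieV Y Z q :=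
  funext fun _ => lieD_congr_field h _

theorem lieD_dotProduct {u v : Cn n → Cn n} (X : CField n) (hu : DifferentiableAt ℝ u q)
    (hv : DifferentiableAt ℝ v q) :
    lieD X (fun z => u z ⬝ᵥ v z) q = lieV X u q ⬝ᵥ v q + u q ⬝ᵥ lieV X v q := by
  have hu' := differentiableAt_pi.1 hu
  have hv' := differentiableAt_pi.1 hv
  simp only [dotProduct]
  rw [lieD_sum X fun j _ => (hu' j).fun_mul (hv' j), ← Finset.sum_add_distrib]
  exact Finset.sum_congr rfl fun j _ => lieD_mul X (hu' j) (hv' j)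

theorem lieV_hol_rhoD (C : Cn n → Cn n) :
    lieV (hol C) (rhoD ρ) q = Matrix.vecMul (C q) (rhoDD ρ q) :=
  funext fun _ => lieD_hol C _ q

theorem lieV_hol_rhoDbar (C : Cn n → Cn n) :
    lieV (hol C) (rhoDbar ρ) q = Matrix.vecMul (C q) (leviMat ρ q) :=
  funext fun _ => lieD_hol C _ q

theorem lieV_conjField_rhoDbar (D : Cn n → Cn n) :
    lieV (conjField D) (rhoDbar ρ) q = star (Matrix.vecMul (D q) (rhoDD ρ q)) := by
  rw [← lieV_hol_rhoD]
  funext k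
  simp only [lieV, Pi.star_apply, ← lieD_conjField_star, rhoDbar_eq_star]

end Connection

/-! ### The connection and its curvature where the complex Hessian is stationary -/

section Curvature

variable {n : ℕ} {ρ : Cn n → ℝ} {p q : Cn n}

/-- A regular point of the level set at which the complex Hessian is nondegenerate and
stationary. -/
structure IsLeviFlatAt (ρ : Cn n → ℝ) (q : Cn n) : Prop where
  smooth : ContDiffAt ℝ 1 ρ q
  smooth_rhoD : ContDiffAt ℝ 1 (rhoD ρ) q
  eq_zero : ρ q = 0
  fderiv_ne : fderiv ℝ ρ q ≠ 0
  hasFDerivAt_leviMat : ∀ j k, HasFDerivAt (fun z => leviMat ρ z j k) (0 : Cn n →L[ℝ] ℂ) q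
  det_ne : (leviMat ρ q).det ≠ 0
  norm_ne : normalNorm ρ q ≠ 0

/-- A `C¹` section of `T^{1,0}` near `q`. -/
def IsC1SectionAt (ρ : Cn n → ℝ) (Z : Cn n → Cn n) (q : Cn n) : Prop :=
  ContDiffAt ℝ 1 Z q ∧ ∀ᶠ z in 𝓝 q, ρ z = 0 → rhoD ρ z ⬝ᵥ Z z = 0

theorem IsC1SectionAt.dotProduct_eq {Z : Cn n → Cn n} (hZ : IsC1SectionAt ρ Z q)
    (h0 : ρ q = 0) : rhoD ρ q ⬝ᵥ Z q = 0 :=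
  hZ.2.self_of_nhds h0

theorem theta_conjField (D : Cn n → Cn n) :
    theta ρ q (conjField D q) = Complex.I * star (rhoD ρ q ⬝ᵥ D q) := by
  rw [← rhoDbar_dotProduct_star]
  rfl

theorem theta_hol (C : Cn n → Cn n) : theta ρ q (hol C q) = 0 := by
  simp [theta, hol]

theorem lieV_zero (X : CField n) : lieV X (fun _ => (0 : Cn n)) q = 0 :=
  funext fun _ => lieD_const X _ q

theorem bracket_antihol_hol_fst (W Y : Cn n → Cn n) :
    (bracket (antihol W) (hol Y) q).1 = lieV (antihol W) Y q := by
  funext k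
  simp [bracket, antihol, hol, lieV, lieD_const]

theorem bracket_antihol_hol_snd (W Y : Cn n → Cn n) :
    (bracket (antihol W) (hol Y) q).2 = -lieV (hol Y) W q := by
  funext k
  simp [bracket, antihol, hol, lieV, lieD_const]

theorem lieV_of_field_eq_zero {X : CField n} (h : X q = 0) (Y : Cn n → Cn n) : lieV X Y q = 0 :=
  funext fun _ => lieD_of_field_eq_zero h _

theorem nabla10_of_eq_zero {X : Cn n → Cn n} (hX : X q = 0) (Y : Cn n → Cn n) :
    nabla10 ρ X Y q = 0 := by
  have h : hol X q = 0 := by rw [hol, hX]; rfl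
  simp [nabla10, lieD_of_field_eq_zero h, sharp, ← Pi.zero_def]

theorem IsLeviFlatAt.lieD_leviMat (h : IsLeviFlatAt ρ q) (X : CField n) (j k : Fin (n + 1)) :
    lieD X (fun z => leviMat ρ z j k) q = 0 :=
  lieD_of_fderiv_eq_zero (h.hasFDerivAt_leviMat j k).fderiv X

theorem IsLeviFlatAt.lieV_vecMul (h : IsLeviFlatAt ρ q) (X : CField n) {Y : Cn n → Cn n}
    (hY : DifferentiableAt ℝ Y q) :
    lieV X (fun z => Matrix.vecMul (Y z) (leviMat ρ z)) q =
      Matrix.vecMul (lieV X Y q) (leviMat ρ q) := by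
  funext k
  have hk : DifferentiableAt ℝ (fun z j => leviMat ρ z j k) q :=
    differentiableAt_pi.2 fun j => (h.hasFDerivAt_leviMat j k).differentiableAt
  have h0 : lieV X (fun z j => leviMat ρ z j k) q = 0 := funext fun j => h.lieD_leviMat X j k
  change lieD X (fun z => Y z ⬝ᵥ fun j => leviMat ρ z j k) q = _
  rw [lieD_dotProduct X hY hk, h0, dotProduct_zero, add_zero]
  rfl

/-- A stationary Hessian commutes with differentiation, so raising the index undoes the lowering
exactly; only the orthogonal projection is left. -/
theorem IsLeviFlatAt.nabla10_eq (h : IsLeviFlatAt ρ q) (X : Cn n → Cn n) {Y : Cn n → Cn n}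
    (hY : DifferentiableAt ℝ Y q) :
    nabla10 ρ X Y q = lieV (hol X) Y q -
      ((rhoD ρ q ⬝ᵥ lieV (hol X) Y q) / normalNorm ρ q) • normalVec ρ q := by
  have hV : (sharp ρ q fun k => lieD (hol X) (fun z => ∑ j, leviMat ρ z j k * Y z j) q) =
      lieV (hol X) Y q := by
    rw [← sharp_vecMul h.det_ne (lieV (hol X) Y q), ← h.lieV_vecMul (hol X) hY]
    congr 1
    funext k
    simp only [lieV, Matrix.vecMul, dotProduct, mul_comm]
  simp only [nabla10, hV, normalNorm]

theorem proj10_hol (C : Cn n → Cn n) : proj10 ρ (hol C) = C := by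
  funext z
  rw [proj10, theta_hol, zero_smul, sub_zero]
  rfl

theorem proj01_hol (C : Cn n → Cn n) : proj01 ρ (hol C) = 0 := by
  funext z
  rw [proj01, theta_hol, zero_smul, sub_zero]
  rfl

theorem nabla_hol (C Y : Cn n → Cn n) : nabla ρ (hol C) Y q = nabla10 ρ C Y q := by
  have h1 : antihol (proj01 ρ (hol C)) q = 0 := by rw [proj01_hol]; rfl
  have h2 : (bracket (antihol (proj01 ρ (hol C))) (hol Y) q).2 = 0 := by
    rw [bracket_antihol_hol_snd, proj01_hol]
    exact neg_eq_zero.2 (lieV_zero _)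
  have h3 : proj10 ρ (bracket (antihol (proj01 ρ (hol C))) (hol Y)) q = 0 := by
    rw [proj10, bracket_antihol_hol_fst, theta, h2, lieV_of_field_eq_zero h1]
    simp
  rw [nabla, h3, theta_hol, proj10_hol, zero_smul, add_zero, add_zero]

/-- Differentiating `∂ρ(Y) = 0` along the tangent vector `C` gives `∂ρ(C Y) = -H(C, Y)`, which
identifies the normal part removed by the projection. -/
theorem IsLeviFlatAt.nabla_hol_eq (h : IsLeviFlatAt ρ q) {C Y : Cn n → Cn n}
    (hC : rhoD ρ q ⬝ᵥ C q = 0) (hY : IsC1SectionAt ρ Y q) :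
    nabla ρ (hol C) Y q = lieV (hol C) Y q +
      (hessForm ρ q (C q) (Y q) / normalNorm ρ q) • normalVec ρ q := by
  have hYd := hY.1.differentiableAt (by norm_num)
  have h0 := lieD_eq_zero_of_vanish h.smooth h.fderiv_ne h.eq_zero
    (contDiffAt_dotProduct (m := 1) h.smooth_rhoD hY.1) hY.2 (X := hol C) (by simp [hol, hC])
  rw [lieD_dotProduct _ (h.smooth_rhoD.differentiableAt (by norm_num)) hYd, lieV_hol_rhoD,
    ← Matrix.dotProduct_mulVec] at h0
  rw [nabla_hol, h.nabla10_eq C hYd, eq_neg_of_add_eq_zero_right h0, hessForm, neg_div, neg_smul,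
    sub_neg_eq_add]

/-- Differentiating `∂̄ρ(D̄) = 0` along `Y` gives `θ([D̄, Y]) = i⟨Y, D̄⟩`. Subtracting this multiple
of the Reeb part `iξ/ν` produces the coefficient `-i · i = 1`. -/
theorem IsLeviFlatAt.nabla_conjField_eq (h : IsLeviFlatAt ρ q) {D Y : Cn n → Cn n}
    (hD : IsC1SectionAt ρ D q) (hY : rhoD ρ q ⬝ᵥ Y q = 0)
    (hW : ContDiffAt ℝ 1 (proj01 ρ (conjField D)) q) :
    nabla ρ (conjField D) Y q = lieV (conjField D) Y q +
      (levi ρ q (Y q) (D q) / normalNorm ρ q) • normalVec ρ q := by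
  have hθ {z : Cn n} (hz : rhoD ρ z ⬝ᵥ D z = 0) : theta ρ z (conjField D z) = 0 := by
    rw [theta_conjField, hz, star_zero, mul_zero]
  have hDq := hD.dotProduct_eq h.eq_zero
  have hDs : ContDiffAt ℝ 1 (fun z => star (D z)) q :=
    contDiffAt_pi.2 fun j => contDiffAt_star (m := 1) (contDiffAt_pi.1 hD.1 j)
  have hρs : ContDiffAt ℝ 1 (rhoDbar ρ) q := by
    have : rhoDbar ρ = fun z => star (rhoD ρ z) := funext (rhoDbar_eq_star ρ)
    rw [this]
    exact contDiffAt_pi.2 fun j => contDiffAt_star (m := 1) (contDiffAt_pi.1 h.smooth_rhoD j)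
  have hYt : rhoD ρ q ⬝ᵥ (hol Y q).1 + rhoDbar ρ q ⬝ᵥ (hol Y q).2 = 0 := by simp [hol, hY]
  have hWq {z : Cn n} (hz : rhoD ρ z ⬝ᵥ D z = 0) : proj01 ρ (conjField D) z = star (D z) := by
    rw [proj01, hθ hz, zero_smul, sub_zero]
    rfl
  have h10 : proj10 ρ (conjField D) q = 0 := by
    rw [proj10, hθ hDq, zero_smul, sub_zero]
    rfl
  -- The `(0,1)`-projection of `D̄` equals `D̄` only on the level set; this suffices because `Y` is
  -- tangent.
  have hYW : lieV (hol Y) (proj01 ρ (conjField D)) q = lieV (hol Y) (fun z => star (D z)) q :=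
    funext fun k => lieD_congr_of_eqOn_level h.smooth h.fderiv_ne h.eq_zero
      (contDiffAt_pi.1 hW k) (contDiffAt_pi.1 hDs k)
      (hD.2.mono fun z hz h0 => by rw [hWq (hz h0)]) hYt
  have h0 := lieD_eq_zero_of_vanish h.smooth h.fderiv_ne h.eq_zero
    (contDiffAt_dotProduct (m := 1) hρs hDs) (hD.2.mono fun z hz h0 => by
      rw [rhoDbar_dotProduct_star, hz h0, star_zero]) hYt
  rw [lieD_dotProduct _ (hρs.differentiableAt (by norm_num)) (hDs.differentiableAt (by norm_num)),
    lieV_hol_rhoDbar, ← levi_eq] at h0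
  have hB : theta ρ q (bracket (antihol (proj01 ρ (conjField D))) (hol Y) q) =
      Complex.I * levi ρ q (Y q) (D q) := by
    rw [eq_neg_of_add_eq_zero_left h0, ← dotProduct_neg, ← hYW, ← bracket_antihol_hol_snd]
    rfl
  have hX : antihol (proj01 ρ (conjField D)) q = conjField D q := by
    rw [antihol, hWq hDq]
    rfl
  rw [nabla, hθ hDq, nabla10_of_eq_zero h10, zero_smul, add_zero, zero_add, proj10, hB,
    bracket_antihol_hol_fst, lieV_congr_field hX, reeb, reeb10, smul_smul, sub_eq_add_neg,
    ← neg_smul]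
  congr 2
  rw [normalNorm]
  linear_combination (-levi ρ q (Y q) (D q) / (rhoD ρ q ⬝ᵥ normalVec ρ q)) * Complex.I_mul_I

end Curvature

/-! ### The Gauss equation -/

section CurvatureFormula

variable {n : ℕ} {ρ : Cn n → ℝ} {p q : Cn n}

theorem lieV_add (X : CField n) {Y Z : Cn n → Cn n} (hY : DifferentiableAt ℝ Y q)
    (hZ : DifferentiableAt ℝ Z q) :
    lieV X (fun z => Y z + Z z) q = lieV X Y q + lieV X Z q :=
  funext fun k => lieD_add X (differentiableAt_pi.1 hY k) (differentiableAt_pi.1 hZ k)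

theorem lieV_smul (X : CField n) {s : Cn n → ℂ} {Z : Cn n → Cn n} (hs : DifferentiableAt ℝ s q)
    (hZ : DifferentiableAt ℝ Z q) :
    lieV X (fun z => s z • Z z) q = lieD X s q • Z q + s q • lieV X Z q :=
  funext fun k => lieD_mul X hs (differentiableAt_pi.1 hZ k)

theorem contDiffAt_lieV {X : CField n} {Y : Cn n → Cn n} (hX : ContDiffAt ℝ ∞ X p)
    (hY : ContDiffAt ℝ ∞ Y p) : ContDiffAt ℝ ∞ (lieV X Y) p :=
  contDiffAt_pi.2 fun k => contDiffAt_lieD hX (contDiffAt_pi.1 hY k)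

theorem lieV_bracket {X Y : CField n} {Z : Cn n → Cn n} (hX : DifferentiableAt ℝ X p)
    (hY : DifferentiableAt ℝ Y p) (hZ : ContDiffAt ℝ ∞ Z p) :
    lieV (bracket X Y) Z p = lieV X (lieV Y Z) p - lieV Y (lieV X Z) p :=
  funext fun k => lieD_bracket hX hY (contDiffAt_pi.1 hZ k)

theorem lieV_decomp (X : CField n) (Y : Cn n → Cn n) :
    lieV X Y q = lieV (hol (proj10 ρ X)) Y q + lieV (antihol (proj01 ρ X)) Y q +
      theta ρ q (X q) • lieV (reeb ρ) Y q := by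
  funext k
  simp only [lieV, lieD, hol, antihol, proj10, proj01, Pi.add_apply, Pi.smul_apply, smul_eq_mul,
    Finset.mul_sum, ← Finset.sum_add_distrib, Pi.sub_apply, Pi.zero_apply]
  exact Finset.sum_congr rfl fun j _ => by ring

theorem levi_reeb (hdet : (leviMat ρ q).det ≠ 0) {W : Cn n} (hW : rhoD ρ q ⬝ᵥ W = 0) :
    levi ρ q (reeb ρ q).1 W = 0 := by
  rw [reeb, reeb10, levi_smul_left, levi_normalVec hdet hW, mul_zero]

theorem levi_proj10 (hdet : (leviMat ρ q).det ≠ 0) {W : Cn n} (hW : rhoD ρ q ⬝ᵥ W = 0)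
    (X : CField n) : levi ρ q (proj10 ρ X q) W = levi ρ q (X q).1 W := by
  rw [proj10, levi_sub_left, levi_smul_left, levi_reeb hdet hW, mul_zero, sub_zero]

/-- Differentiates the identity `∑ ρ_{jk̄} ξ_j = ρ_k̄`, valid near `q`. This is the source of both
Weingarten formulas: `Cξ` pairs like `C`, and `D̄ξ` pairs through the conjugate of `H`. -/
theorem IsLeviFlatAt.vecMul_lieV_normalVec (h : IsLeviFlatAt ρ q) (hρ : ContDiffAt ℝ ∞ ρ q)
    (X : CField n) :
    Matrix.vecMul (lieV X (normalVec ρ) q) (leviMat ρ q) = lieV X (rhoDbar ρ) q := by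
  rw [← h.lieV_vecMul X ((contDiffAt_normalVec hρ h.det_ne).differentiableAt (by simp))]
  funext k
  refine lieD_congr ?_ X
  filter_upwards [(contDiffAt_matrix_det (contDiffAt_leviMat hρ)).continuousAt.eventually_ne
    h.det_ne] with z hz
  rw [vecMul_normalVec hz]

theorem IsLeviFlatAt.levi_lieV_hol_normalVec (h : IsLeviFlatAt ρ q) (hρ : ContDiffAt ℝ ∞ ρ q)
    (C : Cn n → Cn n) (W : Cn n) :
    levi ρ q (lieV (hol C) (normalVec ρ) q) W = levi ρ q (C q) W := by
  rw [levi_eq, h.vecMul_lieV_normalVec hρ, lieV_hol_rhoDbar, levi_eq]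

theorem IsLeviFlatAt.levi_lieV_conjField_normalVec (h : IsLeviFlatAt ρ q)
    (hρ : ContDiffAt ℝ ∞ ρ q) (D : Cn n → Cn n) (W : Cn n) :
    levi ρ q (lieV (conjField D) (normalVec ρ) q) W = star (hessForm ρ q (D q) W) := by
  rw [levi_eq, h.vecMul_lieV_normalVec hρ, lieV_conjField_rhoDbar, hessForm,
    Matrix.dotProduct_mulVec, ← Matrix.star_dotProduct_star, dotProduct_comm]

/-- Modulo the normal direction, `∇_X Y` is the componentwise derivative of `Y`, up to a term
in `θ(X)`. -/
theorem IsLeviFlatAt.levi_nabla (h : IsLeviFlatAt ρ q) (hρ : ContDiffAt ℝ ∞ ρ q) (X : CField n)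
    {Y : Cn n → Cn n} (hY : DifferentiableAt ℝ Y q) {W : Cn n} (hW : rhoD ρ q ⬝ᵥ W = 0) :
    levi ρ q (nabla ρ X Y q) W = levi ρ q (lieV X Y q) W -
      theta ρ q (X q) * (Complex.I / normalNorm ρ q) * levi ρ q (Y q) W := by
  have hN := contDiffAt_normalVec hρ h.det_ne
  have hs : ContDiffAt ℝ ∞ (fun z => Complex.I / normalNorm ρ z) q :=
    contDiffAt_complex_div contDiffAt_const (contDiffAt_normalNorm hρ h.det_ne) h.norm_ne
  have hR : (bracket (reeb ρ) (hol Y) q).1 = lieV (reeb ρ) Y q - lieV (hol Y) (reeb10 ρ) q := rfl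
  -- Paired with a tangent `W`, only the `Yξ` term survives, and it pairs like `Y`. This is where
  -- the `θ(X)` term originates.
  have hr : lieV (hol Y) (reeb10 ρ) q =
      lieD (hol Y) (fun z => Complex.I / normalNorm ρ z) q • normalVec ρ q +
        (Complex.I / normalNorm ρ q) • lieV (hol Y) (normalVec ρ) q :=
    lieV_smul (hol Y) (hs.differentiableAt (by simp)) (hN.differentiableAt (by simp))
  rw [nabla, levi_add_left, levi_add_left, levi_smul_left, levi_proj10 h.det_ne hW,
    levi_proj10 h.det_ne hW, hR, bracket_antihol_hol_fst, h.nabla10_eq _ hY, levi_sub_left,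
    levi_smul_left, levi_normalVec h.det_ne hW, levi_sub_left, hr, levi_add_left, levi_smul_left,
    levi_smul_left, levi_normalVec h.det_ne hW, h.levi_lieV_hol_normalVec hρ,
    lieV_decomp (ρ := ρ) X Y, levi_add_left, levi_add_left, levi_smul_left]
  ring

/-- The contribution of a second covariant derivative, modulo the normal direction. -/
theorem IsLeviFlatAt.levi_lieV_of_eq (h : IsLeviFlatAt ρ q) (hρ : ContDiffAt ℝ ∞ ρ q)
    {X : CField n} (hX : rhoD ρ q ⬝ᵥ (X q).1 + rhoDbar ρ q ⬝ᵥ (X q).2 = 0)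
    {F G : Cn n → Cn n} {s : Cn n → ℂ} (hF : ContDiffAt ℝ ∞ F q) (hG : ContDiffAt ℝ ∞ G q)
    (hs : ContDiffAt ℝ ∞ s q)
    (hv : ∀ᶠ z in 𝓝 q, ρ z = 0 → F z = G z + s z • normalVec ρ z)
    {W : Cn n} (hW : rhoD ρ q ⬝ᵥ W = 0) :
    levi ρ q (lieV X F q) W =
      levi ρ q (lieV X G q) W + s q * levi ρ q (lieV X (normalVec ρ) q) W := by
  have hN := contDiffAt_normalVec hρ h.det_ne
  have hsN : ContDiffAt ℝ ∞ (fun z => s z • normalVec ρ z) q := hs.smul hN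
  have hF' : lieV X F q = lieV X (fun z => G z + s z • normalVec ρ z) q := by
    funext k
    refine lieD_congr_of_eqOn_level h.smooth h.fderiv_ne h.eq_zero
      (contDiffAt_infty.1 (contDiffAt_pi.1 hF k) 1)
      (contDiffAt_infty.1 (contDiffAt_pi.1 (hG.add hsN) k) 1) ?_ hX
    exact hv.mono fun z hz h0 => by rw [hz h0]
  rw [hF', lieV_add X (hG.differentiableAt (by simp)) (hsN.differentiableAt (by simp)),
    lieV_smul X (hs.differentiableAt (by simp)) (hN.differentiableAt (by simp)), levi_add_left,
    levi_add_left, levi_smul_left, levi_smul_left, levi_normalVec h.det_ne hW]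
  ring

theorem contDiffAt_levi {Z W : Cn n → Cn n} (hρ : ContDiffAt ℝ ∞ ρ p)
    (hZ : ContDiffAt ℝ ∞ Z p) (hW : ContDiffAt ℝ ∞ W p) :
    ContDiffAt ℝ ∞ (fun z => levi ρ z (Z z) (W z)) p := by
  simp only [levi_eq]
  exact contDiffAt_dotProduct (contDiffAt_pi.2 fun k => contDiffAt_dotProduct hZ
    (contDiffAt_pi.2 fun j => contDiffAt_leviMat hρ j k)) (contDiffAt_star_pi hW)

theorem contDiffAt_hessForm {Z W : Cn n → Cn n} (hρ : ContDiffAt ℝ ∞ ρ p)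
    (hZ : ContDiffAt ℝ ∞ Z p) (hW : ContDiffAt ℝ ∞ W p) :
    ContDiffAt ℝ ∞ (fun z => hessForm ρ z (Z z) (W z)) p :=
  contDiffAt_dotProduct hZ (contDiffAt_pi.2 fun j => contDiffAt_dotProduct
    (contDiffAt_pi.2 fun k => contDiffAt_rhoDD hρ j k) hW)

/-- `ContDiffAt ℝ ∞` at `p` gives each finite order on a neighbourhood depending on that order. The
formulas needed at nearby points are therefore stated for `C¹` sections. -/
theorem IsSectionAt.eventually_isC1SectionAt {Z : Cn n → Cn n} (hZ : IsSectionAt ρ Z p) :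
    ∀ᶠ z in 𝓝 p, IsC1SectionAt ρ Z z :=
  ((contDiffAt_infty.1 hZ.1 1).eventually (by simp)).and hZ.2.eventually_nhds

/-- Obtained by differentiating `∂̄ρ(D̄) = 0` along `C`. This Reeb component yields the term `⟨C,
D̄⟩⟨A, B̄⟩` of the curvature. -/
theorem theta_bracket {C D : Cn n → Cn n} (h : IsLeviFlatAt ρ p) (hρ : ContDiffAt ℝ ∞ ρ p)
    (hC : IsSectionAt ρ C p) (hD : IsSectionAt ρ D p) :
    theta ρ p (bracket (hol C) (conjField D) p) = -Complex.I * levi ρ p (C p) (D p) := by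
  have hDs := contDiffAt_star_pi hD.1
  have hb := contDiffAt_rhoDbar hρ
  have hB : (bracket (hol C) (conjField D) p).2 = lieV (hol C) (fun z => star (D z)) p := by
    funext k
    simp [bracket, conjField, antihol, hol, lieV, lieD_const]
  have h0 := lieD_eq_zero_of_vanish h.smooth h.fderiv_ne h.eq_zero
    (contDiffAt_infty.1 (contDiffAt_dotProduct hb hDs) 1)
    (hD.2.mono fun z hz h0 => by rw [rhoDbar_dotProduct_star, hz h0, star_zero]) (X := hol C)
    (by simp [hol, hC.2.self_of_nhds h.eq_zero])
  rw [lieD_dotProduct _ (hb.differentiableAt (by simp)) (hDs.differentiableAt (by simp)),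
    lieV_hol_rhoDbar, ← levi_eq] at h0
  change Complex.I * (rhoDbar ρ p ⬝ᵥ (bracket (hol C) (conjField D) p).2) = _
  rw [hB, eq_neg_of_add_eq_zero_right h0]
  ring

/-- The Gauss equation: the Tanaka–Webster curvature of a level set along which the complex
Hessian is stationary. -/
theorem curvTensor_eq (hρ : ContDiffAt ℝ ∞ ρ p) (h0 : ρ p = 0)
    (hflat : ∀ᶠ z in 𝓝 p, ρ z = 0 → IsLeviFlatAt ρ z) {A B C D : Cn n → Cn n}
    (hA : IsSectionAt ρ A p) (hB : rhoD ρ p ⬝ᵥ B p = 0) (hC : IsSectionAt ρ C p)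
    (hD : IsSectionAt ρ D p) :
    curvTensor ρ A B C D p =
      (levi ρ p (A p) (D p) * levi ρ p (C p) (B p) + levi ρ p (C p) (D p) * levi ρ p (A p) (B p) -
        hessForm ρ p (C p) (A p) * star (hessForm ρ p (D p) (B p))) / normalNorm ρ p := by
  have h := hflat.self_of_nhds h0
  have hν := contDiffAt_normalNorm hρ h.det_ne
  have hcC := contDiffAt_hol hC.1
  have hcD := contDiffAt_conjField hD.1
  have hF1 := contDiffAt_nabla hρ h.det_ne h.norm_ne hcD hA.1
  have hF2 := contDiffAt_nabla hρ h.det_ne h.norm_ne hcC hA.1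
  have hCp := hC.2.self_of_nhds h0
  have hDp := hD.2.self_of_nhds h0
  have hW := (contDiffAt_infty.1 (contDiffAt_proj01 hρ h.det_ne h.norm_ne hcD) 1).eventually
    (by simp)
  -- On the level set `∇_D̄ A = D̄A + (⟨A, D̄⟩/ν) ξ`, and `Cξ` pairs like `C`.
  have e1 : levi ρ p (nabla ρ (hol C) (nabla ρ (conjField D) A) p) (B p) =
      levi ρ p (lieV (hol C) (lieV (conjField D) A) p) (B p) +
        levi ρ p (A p) (D p) / normalNorm ρ p * levi ρ p (C p) (B p) := by
    rw [h.levi_nabla hρ _ (hF1.differentiableAt (by simp)) hB, theta_hol,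
      h.levi_lieV_of_eq hρ (by simp [hol, hCp]) hF1 (contDiffAt_lieV hcD hA.1)
        (contDiffAt_complex_div (contDiffAt_levi hρ hA.1 hD.1) hν h.norm_ne) ?_ hB,
      h.levi_lieV_hol_normalVec hρ]
    · ring
    · filter_upwards [hflat, hD.eventually_isC1SectionAt, hA.2, hW] with z hz hDz hAz hWz hz0
      exact (hz hz0).nabla_conjField_eq hDz (hAz hz0) hWz
  -- On the level set `∇_C A = CA + (H(C, A)/ν) ξ`, and `D̄ξ` pairs with `B` to `conj H(D, B)`.
  have e2 : levi ρ p (nabla ρ (conjField D) (nabla ρ (hol C) A) p) (B p) =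
      levi ρ p (lieV (conjField D) (lieV (hol C) A) p) (B p) +
        hessForm ρ p (C p) (A p) / normalNorm ρ p * star (hessForm ρ p (D p) (B p)) := by
    rw [h.levi_nabla hρ _ (hF2.differentiableAt (by simp)) hB, theta_conjField, hDp,
      h.levi_lieV_of_eq hρ (by simp [conjField, antihol, rhoDbar_dotProduct_star, hDp]) hF2
        (contDiffAt_lieV hcC hA.1)
        (contDiffAt_complex_div (contDiffAt_hessForm hρ hC.1 hA.1) hν h.norm_ne) ?_ hB,
      h.levi_lieV_conjField_normalVec hρ, star_zero]
    · ring
    · filter_upwards [hflat, hC.2, hA.eventually_isC1SectionAt] with z hz hCz hAz hz0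
      exact (hz hz0).nabla_hol_eq (hCz hz0) hAz
  rw [curvTensor, curv, levi_sub_left, levi_sub_left, e1, e2,
    h.levi_nabla hρ _ (hA.1.differentiableAt (by simp)) hB, theta_bracket h hρ hC hD,
    lieV_bracket (hcC.differentiableAt (by simp)) (hcD.differentiableAt (by simp)) hA.1,
    levi_sub_left]
  linear_combination (-levi ρ p (C p) (D p) * levi ρ p (A p) (B p) / normalNorm ρ p) *
    Complex.I_mul_I

end CurvatureFormula

section CConvex

variable {n : ℕ} {ρ : Cn n → ℝ} {p q : Cn n}

/-! ### Consequences of positivity of the complex Hessian -/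

theorem fderiv_eq_zero_of_rhoD_eq_zero (hρ : DifferentiableAt ℝ ρ q) (h : rhoD ρ q = 0) :
    fderiv ℝ ρ q = 0 := by
  have hb : rhoDbar ρ q = 0 := by rw [rhoDbar_eq_star, h, star_zero]
  have hc : fderiv ℝ (fun z => (ρ z : ℂ)) q = Complex.ofRealCLM.comp (fderiv ℝ ρ q) :=
    (Complex.ofRealCLM.hasFDerivAt.comp q hρ.hasFDerivAt).fderiv
  have h1 (j) : fderiv ℝ ρ q (Pi.single j 1) = 0 ∧ fderiv ℝ ρ q (Pi.single j Complex.I) = 0 := by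
    have e1 := congrFun h j
    have e2 := congrFun hb j
    simp only [rhoD, rhoDbar, dz, dzbar, hc, ContinuousLinearMap.comp_apply,
      Complex.ofRealCLM_apply, Pi.zero_apply] at e1 e2
    constructor
    · have : ((fderiv ℝ ρ q (Pi.single j 1) : ℝ) : ℂ) = 0 := by linear_combination e1 + e2
      exact_mod_cast this
    · have : Complex.I * ((fderiv ℝ ρ q (Pi.single j Complex.I) : ℝ) : ℂ) = 0 := by
        linear_combination e2 - e1
      exact_mod_cast (mul_eq_zero.1 this).resolve_left Complex.I_ne_zero
  ext v
  have hv : v = ∑ j, ((v j).re • (Pi.single j 1 : Cn n) + (v j).im • (Pi.single j Complex.I : Cn n)) := by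
    funext k
    rw [Finset.sum_apply, Finset.sum_eq_single k]
    · simp
    · intro j _ hj
      simp [hj.symm]
    · simp
  rw [hv, map_sum]
  refine Finset.sum_eq_zero fun j _ => ?_
  rw [map_add, map_smul, map_smul, (h1 j).1, (h1 j).2]
  simp

theorem normalNorm_eq (ρ : Cn n → ℝ) (q : Cn n) :
    normalNorm ρ q = star (rhoD ρ q) ⬝ᵥ (leviMat ρ q)⁻¹.mulVec (rhoD ρ q) := by
  rw [normalNorm, normalVec, sharp, dotProduct_comm, ← Matrix.dotProduct_mulVec, rhoDbar_eq_star]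

theorem normalNorm_pos (hρ : DifferentiableAt ℝ ρ q) (hd : fderiv ℝ ρ q ≠ 0)
    (hL : (leviMat ρ q).PosDef) : 0 < normalNorm ρ q := by
  rw [normalNorm_eq]
  exact hL.inv.dotProduct_mulVec_pos fun h => hd (fderiv_eq_zero_of_rhoD_eq_zero hρ h)

theorem levi_self_pos (hL : (leviMat ρ q).PosDef) {Z : Cn n} (hZ : Z ≠ 0) :
    0 < levi ρ q Z Z := by
  rw [levi_eq, ← Matrix.dotProduct_mulVec]
  simpa using hL.dotProduct_mulVec_pos (star_ne_zero.2 hZ)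

theorem isLeviFlatAt_of_posDef (hρ : ContDiffAt ℝ 1 ρ q) (hρD : ContDiffAt ℝ 1 (rhoD ρ) q)
    (h0 : ρ q = 0) (hd : fderiv ℝ ρ q ≠ 0) (hL : (leviMat ρ q).PosDef)
    (hflat : ∀ j k, HasFDerivAt (fun z => leviMat ρ z j k) (0 : Cn n →L[ℝ] ℂ) q) :
    IsLeviFlatAt ρ q where
  smooth := hρ
  smooth_rhoD := hρD
  eq_zero := h0
  fderiv_ne := hd
  hasFDerivAt_leviMat := hflat
  det_ne := hL.det_pos.ne'
  norm_ne := (normalNorm_pos (hρ.differentiableAt (by norm_num)) hd hL).ne'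

/-- The filter `𝓝 q` includes `q` itself, where the bound by `|ρ|` is a bound by zero. -/
theorem leviMat_eq_of_isLittleO {a : Matrix (Fin (n + 1)) (Fin (n + 1)) ℂ} (h0 : ρ q = 0)
    (ha : ∀ j k, (fun z => leviMat ρ z j k - a j k) =o[𝓝 q] ρ) : leviMat ρ q = a := by
  ext j k
  have h := ((ha j k).def one_pos).self_of_nhds
  rw [h0, norm_zero, mul_zero, norm_le_zero_iff] at h
  exact sub_eq_zero.1 h

/-- Since `ρ(q) = 0`, `ρ = O(z - q)`, so an error `o(ρ)` is `o(z - q)`. -/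
theorem hasFDerivAt_leviMat_of_isLittleO {a : Matrix (Fin (n + 1)) (Fin (n + 1)) ℂ}
    (hρ : DifferentiableAt ℝ ρ q) (h0 : ρ q = 0)
    (ha : ∀ j k, (fun z => leviMat ρ z j k - a j k) =o[𝓝 q] ρ) (j k : Fin (n + 1)) :
    HasFDerivAt (fun z => leviMat ρ z j k) (0 : Cn n →L[ℝ] ℂ) q := by
  have hO : ρ =O[𝓝 q] fun z => z - q := by
    simpa [h0] using hρ.isBigO_sub
  refine .of_isLittleO ?_
  simpa [leviMat_eq_of_isLittleO h0 ha] using (ha j k).trans_isBigO hO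

theorem normSqD_eq {a : Matrix (Fin (n + 1)) (Fin (n + 1)) ℂ} (ha : leviMat ρ q = a) :
    normSqD a ρ q = (normalNorm ρ q).re := by
  rw [normSqD, normalNorm, normalVec, sharp, ha]
  simp only [dotProduct, Matrix.vecMul, Finset.mul_sum]
  congr 1
  exact Finset.sum_congr rfl fun j _ => Finset.sum_congr rfl fun k _ => by ring

theorem hess_eq (ρ : Cn n → ℝ) (q η : Cn n) :
    hess ρ q η = (hessForm ρ q η η).re + (levi ρ q η η).re := by
  rw [hess, hessForm, levi_eq]
  simp only [dotProduct, Matrix.vecMul, Matrix.mulVec, Finset.mul_sum, Finset.sum_mul]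
  congr 2
  · exact Finset.sum_congr rfl fun j _ => Finset.sum_congr rfl fun k _ => by ring
  · rw [Finset.sum_comm]
    exact Finset.sum_congr rfl fun j _ => Finset.sum_congr rfl fun k _ => by
      rw [Pi.star_apply]; ring

theorem hessForm_smul_smul (ρ : Cn n → ℝ) (q : Cn n) (c : ℂ) (Z : Cn n) :
    hessForm ρ q (c • Z) (c • Z) = c ^ 2 * hessForm ρ q Z Z := by
  rw [hessForm, Matrix.mulVec_smul, smul_dotProduct, dotProduct_smul, hessForm, smul_eq_mul,
    smul_eq_mul]
  ring

theorem levi_smul_smul (ρ : Cn n → ℝ) (q : Cn n) (c : ℂ) (Z : Cn n) :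
    levi ρ q (c • Z) (c • Z) = (‖c‖ ^ 2 : ℝ) * levi ρ q Z Z := by
  rw [levi_smul_left, levi_eq, star_smul, dotProduct_smul, ← levi_eq, smul_eq_mul, ← mul_assoc]
  congr 1
  rw [Complex.star_def, Complex.mul_conj, Complex.normSq_eq_norm_sq]

theorem norm_hessForm_le {Z : Cn n}
    (hconv : ∀ η : Cn n, rhoD ρ q ⬝ᵥ η = 0 → 0 ≤ hess ρ q η) (hZ : rhoD ρ q ⬝ᵥ Z = 0) :
    ‖hessForm ρ q Z Z‖ ≤ (levi ρ q Z Z).re := by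
  set H := hessForm ρ q Z Z with hH
  -- The phase `c` makes the quadratic term equal to `-‖H‖` and leaves the Levi term unchanged, so
  -- convexity at `c • Z` is the claim.
  obtain ⟨c, hc1, hc⟩ : ∃ c : ℂ, ‖c‖ = 1 ∧ c ^ 2 * H = -(‖H‖ : ℂ) := by
    by_cases h0 : H = 0
    · exact ⟨1, by simp, by simp [h0]⟩
    · have hn : (‖H‖ : ℂ) ≠ 0 := by simpa using h0
      obtain ⟨c, hc⟩ := IsAlgClosed.exists_pow_nat_eq (-((‖H‖ : ℂ) / H)) two_pos
      refine ⟨c, ?_, ?_⟩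
      · have : ‖c‖ ^ 2 = 1 := by
          rw [← norm_pow, hc]
          simp [h0]
        exact (pow_eq_one_iff_of_nonneg (norm_nonneg _) two_ne_zero).1 this
      · rw [hc]
        field_simp
  have h := hconv (c • Z) (by rw [dotProduct_smul, hZ, smul_zero])
  rw [hess_eq, hessForm_smul_smul, levi_smul_smul, ← hH, hc, hc1] at h
  simpa using h

theorem le_holSecCurv {Z : Cn n → Cn n} (hρ : ContDiffAt ℝ ∞ ρ p) (h0 : ρ p = 0)
    (hflat : ∀ᶠ z in 𝓝 p, ρ z = 0 → IsLeviFlatAt ρ z) (hL : (leviMat ρ p).PosDef)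
    (hconv : ∀ η : Cn n, rhoD ρ p ⬝ᵥ η = 0 → 0 ≤ hess ρ p η) (hZ : IsSectionAt ρ Z p)
    (hZ0 : Z p ≠ 0) : 1 / 2 * (normalNorm ρ p).re⁻¹ ≤ holSecCurv ρ Z p := by
  have hZp := hZ.2.self_of_nhds h0
  have hH := norm_hessForm_le hconv hZp
  have hν := normalNorm_pos (hρ.differentiableAt (by simp)) (hflat.self_of_nhds h0).fderiv_ne hL
  have hl := levi_self_pos hL hZ0
  rw [holSecCurv, curvTensor_eq hρ h0 hflat hZ hZp hZ hZ]
  generalize hessForm ρ p (Z p) (Z p) = H at *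
  generalize levi ρ p (Z p) (Z p) = l at *
  generalize normalNorm ρ p = ν at *
  obtain ⟨l, hl', rfl⟩ := RCLike.pos_iff_exists_ofReal.1 hl
  obtain ⟨r, hr, rfl⟩ := RCLike.pos_iff_exists_ofReal.1 hν
  simp only [Complex.coe_algebraMap] at *
  have hHH : H * star H = ((‖H‖ ^ 2 : ℝ) : ℂ) := by
    rw [Complex.star_def, Complex.mul_conj, Complex.normSq_eq_norm_sq]
  rw [hHH]
  norm_cast at *
  -- The Gauss numerator is `2l² - ‖H‖²`, hence at least `l²`.
  have hH2 : ‖H‖ ^ 2 ≤ l ^ 2 := by gcongr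
  rw [le_div_iff₀ (by positivity), mul_assoc]
  gcongr
  rw [inv_mul_le_iff₀ hr, mul_div_cancel₀ _ hr.ne']
  linarith

end CConvex

/-! ### A trace inequality -/

section Trace

open Matrix

theorem trace_mul_diagonal_nonneg {ι : Type*} [Fintype ι] [DecidableEq ι] {X : Matrix ι ι ℂ}
    (hX : X.PosSemidef) {d : ι → ℂ} (hd : ∀ i, 0 ≤ d i) : 0 ≤ (X * diagonal d).trace := by
  simp only [trace, diag_apply, mul_diagonal]
  exact Finset.sum_nonneg fun i _ => mul_nonneg hX.diag_nonneg (hd i)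

/-- In the application the rows of `P` are a frame, and `L`, `S` are the two ambient Hessians. `W`
is the inverse of the induced metric, carried back to the ambient space, and `N = L⁻¹ - Wᵀ` is the
complementary normal part, which is positive semidefinite. Replacing `Wᵀ` by `L⁻¹` only increases
the trace, so `tr(Wᵀ S W S) ≤ tr(W S L⁻¹ S) ≤ tr(W L) = card κ`, the second inequality by `s² ≤ l²`.
-/
theorem trace_hess_le {ι κ : Type*} [Fintype ι] [DecidableEq ι] [Fintype κ] [DecidableEq κ]
    (P : Matrix κ ι ℂ) (l s : ι → ℝ) (hl : ∀ i, 0 < l i) (hs : ∀ i, s i ^ 2 ≤ l i ^ 2)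
    {h H : Matrix κ κ ℂ} (hh : h = P * diagonal (fun i => (l i : ℂ)) * Pᴴ)
    (hH : H = P * diagonal (fun i => (s i : ℂ)) * Pᵀ) (hpos : h.PosDef) :
    (h⁻¹ᵀ * Hᴴ * h⁻¹ * H).trace ≤ Fintype.card κ := by
  set L : Matrix ι ι ℂ := diagonal fun i => (l i : ℂ) with hL
  set S : Matrix ι ι ℂ := diagonal fun i => (s i : ℂ) with hS
  set K : Matrix ι ι ℂ := diagonal fun i => ((l i)⁻¹ : ℂ) with hK
  set W := Pᴴ * h⁻¹ * P with hWdef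
  set N := K - Wᵀ with hN
  have hl0 (i) : (l i : ℂ) ≠ 0 := by exact_mod_cast (hl i).ne'
  have hLK : L * K = 1 := by simp [hL, hK, hl0]
  have hKL : K * L = 1 := by simp [hL, hK, hl0]
  have hW : W.PosSemidef := hpos.inv.posSemidef.conjTranspose_mul_mul_same P
  have hdet : IsUnit h.det := hpos.det_pos.ne'.isUnit
  have hinv : h⁻¹ * h = 1 := nonsing_inv_mul h hdet
  have hSH : Sᴴ = S := by simp [hS, diagonal_conjTranspose, Pi.star_def]
  have hKH : Kᴴ = K := by simp [hK, diagonal_conjTranspose, Pi.star_def]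
  have hLT : Lᵀ = L := diagonal_transpose _
  -- `W L` is idempotent. The same identity passes to `Wᵀ` and to `N`.
  have hWLW : W * L * W = W := by
    have : W * L * W = Pᴴ * (h⁻¹ * (P * L * Pᴴ) * h⁻¹) * P := by
      simp only [hWdef, Matrix.mul_assoc]
    rw [this, ← hh, hinv, Matrix.one_mul]
  have hWLW' : Wᵀ * L * Wᵀ = Wᵀ := by
    conv_rhs => rw [← hWLW]
    rw [transpose_mul (W * L) W, transpose_mul W L, hLT, Matrix.mul_assoc]
  have hNLN : N * L * N = N := by
    rw [hN, Matrix.sub_mul, Matrix.mul_sub, Matrix.sub_mul, Matrix.sub_mul, hKL, hWLW',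
      Matrix.one_mul, Matrix.one_mul, Matrix.mul_assoc Wᵀ, hLK, Matrix.mul_one]
    abel
  have hNH : Nᴴ = N := by
    rw [hN, conjTranspose_sub, hKH, hW.transpose.1]
  have hT : (h⁻¹ᵀ * Hᴴ * h⁻¹ * H).trace = (Wᵀ * S * W * S).trace := by
    have h1 : Hᴴ = Pᴴᵀ * S * Pᴴ := by
      rw [hH, conjTranspose_mul, conjTranspose_mul, hSH, ← Matrix.mul_assoc]
      rfl
    have h2 : Wᵀ = Pᵀ * (h⁻¹ᵀ * Pᴴᵀ) := by
      rw [hWdef, transpose_mul, transpose_mul]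
    have h3 : h⁻¹ᵀ * Hᴴ * h⁻¹ * H = (h⁻¹ᵀ * Pᴴᵀ * S * W * S) * Pᵀ := by
      rw [h1, hH, hWdef]
      simp only [Matrix.mul_assoc]
    rw [h3, trace_mul_comm, h2]
    simp only [Matrix.mul_assoc]
  -- Writing `N = N L N` and cycling gives the trace of the positive semidefinite `N S W S N`
  -- against the positive diagonal `L`.
  have hA : 0 ≤ (N * (S * W * S)).trace := by
    have h1 : (N * (S * W * S)).trace = (Nᴴ * (Sᴴ * W * S) * N * L).trace := by
      conv_lhs => rw [← hNLN]
      rw [hNH, hSH, Matrix.mul_assoc (N * L), Matrix.mul_assoc N L, trace_mul_comm N,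
        trace_mul_comm _ L]
      simp only [Matrix.mul_assoc]
    rw [h1]
    exact trace_mul_diagonal_nonneg ((hW.conjTranspose_mul_mul_same S).conjTranspose_mul_mul_same N)
      fun i => by exact_mod_cast (hl i).le
  have hB : 0 ≤ (W * L).trace - (K * (S * W * S)).trace := by
    have h1 : (K * (S * W * S)).trace = (W * (S * K * S)).trace := by
      rw [← Matrix.mul_assoc, ← Matrix.mul_assoc, Matrix.mul_assoc (K * S), trace_mul_comm]
      simp only [Matrix.mul_assoc]
    have h2 : L - S * K * S = diagonal fun i => ((l i - s i ^ 2 / l i : ℝ) : ℂ) := by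
      rw [hL, hS, hK, diagonal_mul_diagonal, diagonal_mul_diagonal, diagonal_sub]
      congr 1
      funext i
      push_cast
      ring
    rw [h1, ← trace_sub, ← Matrix.mul_sub, h2]
    refine trace_mul_diagonal_nonneg hW fun i => ?_
    have h3 : s i ^ 2 / l i ≤ l i := by
      rw [div_le_iff₀ (hl i), ← sq]
      exact hs i
    exact_mod_cast sub_nonneg.2 h3
  have hC : (W * L).trace = Fintype.card κ := by
    rw [hWdef, Matrix.mul_assoc, Matrix.mul_assoc, trace_mul_comm, Matrix.mul_assoc, ← hh, hinv,
      trace_one]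
  have hD : (N * (S * W * S)).trace = (K * (S * W * S)).trace - (Wᵀ * S * W * S).trace := by
    rw [hN, Matrix.sub_mul, trace_sub]
    simp only [Matrix.mul_assoc]
  rw [hD] at hA
  rw [hC] at hB
  rw [hT]
  have := add_nonneg hA hB
  rw [← sub_nonneg]
  convert this using 1
  ring

end Trace

/-! ### Ellipsoids -/

section Ellipsoid

open Matrix

variable {n : ℕ} (a b : Fin (n + 1) → ℝ)

theorem contDiff_ellipsoidFn : ContDiff ℝ ∞ (ellipsoidFn a b) := by
  have hc (j) : ContDiff ℝ ∞ (fun z : Cn n => z j) := contDiff_apply ℝ ℂ j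
  have hre (j) : ContDiff ℝ ∞ (fun z : Cn n => (z j).re) := Complex.reCLM.contDiff.comp (hc j)
  have him (j) : ContDiff ℝ ∞ (fun z : Cn n => (z j).im) := Complex.imCLM.contDiff.comp (hc j)
  exact (ContDiff.sum fun j _ => (contDiff_const.mul ((hre j).pow 2)).add
    (contDiff_const.mul ((him j).pow 2))).sub contDiff_const

theorem fderiv_ellipsoidFn_apply (z v : Cn n) :
    fderiv ℝ (ellipsoidFn a b) z v =
      ∑ j, (2 * a j * (z j).re * (v j).re + 2 * b j * (z j).im * (v j).im) := by
  have hre (j) : HasFDerivAt (fun z : Cn n => (z j).re)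
      (Complex.reCLM.comp (ContinuousLinearMap.proj j)) z :=
    (Complex.reCLM.comp (ContinuousLinearMap.proj (R := ℝ) (φ := fun _ => ℂ) j)).hasFDerivAt
  have him (j) : HasFDerivAt (fun z : Cn n => (z j).im)
      (Complex.imCLM.comp (ContinuousLinearMap.proj j)) z :=
    (Complex.imCLM.comp (ContinuousLinearMap.proj (R := ℝ) (φ := fun _ => ℂ) j)).hasFDerivAt
  have h := (HasFDerivAt.fun_sum fun j (_ : j ∈ Finset.univ) =>
    (((hre j).pow 2).const_mul (a j)).fun_add (((him j).pow 2).const_mul (b j))).sub_const 1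
  have h' : fderiv ℝ (ellipsoidFn a b) z = _ := h.fderiv
  rw [h']
  simp only [_root_.sum_apply, _root_.add_apply, _root_.smul_apply, ContinuousLinearMap.comp_apply,
    ContinuousLinearMap.proj_apply, Complex.reCLM_apply, Complex.imCLM_apply, smul_eq_mul]
  refine Finset.sum_congr rfl fun j _ => ?_
  norm_num
  ring

theorem fderiv_ofReal_ellipsoidFn_apply (z v : Cn n) :
    fderiv ℝ (fun z => (ellipsoidFn a b z : ℂ)) z v = ((fderiv ℝ (ellipsoidFn a b) z v : ℝ) : ℂ) := by
  have h : fderiv ℝ (fun z => (ellipsoidFn a b z : ℂ)) z = _ :=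
    (Complex.ofRealCLM.hasFDerivAt.comp z
      ((contDiff_ellipsoidFn a b).differentiable (by simp) z).hasFDerivAt).fderiv
  rw [h]
  rfl

theorem fderiv_ellipsoidFn_single_one (z : Cn n) (j : Fin (n + 1)) :
    fderiv ℝ (ellipsoidFn a b) z (Pi.single j 1) = 2 * a j * (z j).re := by
  rw [fderiv_ellipsoidFn_apply, Finset.sum_eq_single j]
  · simp
  · intro k _ hk
    simp [hk]
  · simp

theorem fderiv_ellipsoidFn_single_I (z : Cn n) (j : Fin (n + 1)) :
    fderiv ℝ (ellipsoidFn a b) z (Pi.single j Complex.I) = 2 * b j * (z j).im := by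
  rw [fderiv_ellipsoidFn_apply, Finset.sum_eq_single j]
  · simp
  · intro k _ hk
    simp [hk]
  · simp

theorem rhoD_ellipsoidFn (z : Cn n) (j : Fin (n + 1)) :
    rhoD (ellipsoidFn a b) z j = a j * (z j).re - Complex.I * (b j * (z j).im) := by
  rw [rhoD, dz, fderiv_ofReal_ellipsoidFn_apply, fderiv_ofReal_ellipsoidFn_apply,
    fderiv_ellipsoidFn_single_one, fderiv_ellipsoidFn_single_I]
  push_cast
  ring

theorem rhoDbar_ellipsoidFn (z : Cn n) (j : Fin (n + 1)) :
    rhoDbar (ellipsoidFn a b) z j = a j * (z j).re + Complex.I * (b j * (z j).im) := by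
  rw [rhoDbar, dzbar, fderiv_ofReal_ellipsoidFn_apply, fderiv_ofReal_ellipsoidFn_apply,
    fderiv_ellipsoidFn_single_one, fderiv_ellipsoidFn_single_I]
  push_cast
  ring

theorem fderiv_re_im_apply (c d : ℂ) (k : Fin (n + 1)) (z v : Cn n) :
    fderiv ℝ (fun z : Cn n => c * ((z k).re : ℂ) + d * ((z k).im : ℂ)) z v =
      c * ((v k).re : ℂ) + d * ((v k).im : ℂ) := by
  have hre : HasFDerivAt (fun z : Cn n => ((z k).re : ℂ))
      (Complex.ofRealCLM.comp (Complex.reCLM.comp (ContinuousLinearMap.proj k))) z :=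
    (Complex.ofRealCLM.comp (Complex.reCLM.comp
      (ContinuousLinearMap.proj (R := ℝ) (φ := fun _ => ℂ) k))).hasFDerivAt
  have him : HasFDerivAt (fun z : Cn n => ((z k).im : ℂ))
      (Complex.ofRealCLM.comp (Complex.imCLM.comp (ContinuousLinearMap.proj k))) z :=
    (Complex.ofRealCLM.comp (Complex.imCLM.comp
      (ContinuousLinearMap.proj (R := ℝ) (φ := fun _ => ℂ) k))).hasFDerivAt
  rw [((hre.const_mul c).fun_add (him.const_mul d)).fderiv]
  simp

theorem leviMat_ellipsoidFn (z : Cn n) :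
    leviMat (ellipsoidFn a b) z = diagonal fun j => (((a j + b j) / 2 : ℝ) : ℂ) := by
  ext j k
  have h : (fun q => rhoDbar (ellipsoidFn a b) q k) =
      fun q => (a k : ℂ) * ((q k).re : ℂ) + (Complex.I * b k) * ((q k).im : ℂ) := by
    funext q
    rw [rhoDbar_ellipsoidFn]
    ring
  rw [leviMat, h, dz, fderiv_re_im_apply, fderiv_re_im_apply]
  by_cases hjk : j = k
  · subst hjk
    simp only [Pi.single_eq_same, Complex.one_re, Complex.one_im, Complex.I_re, Complex.I_im,
      diagonal_apply_eq, Complex.ofReal_one, Complex.ofReal_zero]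
    push_cast
    linear_combination (-(b j : ℂ) / 2) * Complex.I_mul_I
  · simp [Ne.symm hjk, hjk]

theorem rhoDD_ellipsoidFn (z : Cn n) :
    rhoDD (ellipsoidFn a b) z = diagonal fun j => (((a j - b j) / 2 : ℝ) : ℂ) := by
  ext j k
  have h : (fun q => rhoD (ellipsoidFn a b) q k) =
      fun q => (a k : ℂ) * ((q k).re : ℂ) + (-Complex.I * b k) * ((q k).im : ℂ) := by
    funext q
    rw [rhoD_ellipsoidFn]
    ring
  rw [rhoDD, h, dz, fderiv_re_im_apply, fderiv_re_im_apply]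
  by_cases hjk : j = k
  · subst hjk
    simp only [Pi.single_eq_same, Complex.one_re, Complex.one_im, Complex.I_re, Complex.I_im,
      diagonal_apply_eq, Complex.ofReal_one, Complex.ofReal_zero]
    push_cast
    linear_combination ((b j : ℂ) / 2) * Complex.I_mul_I
  · simp [Ne.symm hjk, hjk]

variable {a b}

theorem posDef_leviMat_ellipsoidFn (ha : ∀ j, 0 < a j) (hb : ∀ j, 0 < b j) (z : Cn n) :
    (leviMat (ellipsoidFn a b) z).PosDef := by
  rw [leviMat_ellipsoidFn, posDef_diagonal_iff]
  intro j
  have := add_pos (ha j) (hb j)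
  exact_mod_cast half_pos this

theorem isLeviFlatAt_ellipsoidFn (ha : ∀ j, 0 < a j) (hb : ∀ j, 0 < b j) {z : Cn n}
    (hz : ellipsoidFn a b z = 0) : IsLeviFlatAt (ellipsoidFn a b) z := by
  have hρ := (contDiff_ellipsoidFn a b).contDiffAt (x := z)
  refine isLeviFlatAt_of_posDef (contDiffAt_infty.1 hρ 1)
    (contDiffAt_infty.1 (contDiffAt_rhoD hρ) 1) hz ?_ (posDef_leviMat_ellipsoidFn ha hb z) ?_
  · intro h
    -- Euler's identity: the differential at `z` applied to `z` is `2(ρ + 1)`, which is `2` on the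
    -- ellipsoid.
    have h1 := fderiv_ellipsoidFn_apply a b z z
    have h2 : ∑ j, (2 * a j * (z j).re * (z j).re + 2 * b j * (z j).im * (z j).im) =
        2 * (ellipsoidFn a b z + 1) := by
      rw [ellipsoidFn, sub_add_cancel, Finset.mul_sum]
      exact Finset.sum_congr rfl fun j _ => by ring
    rw [h, h2, hz] at h1
    norm_num at h1
  · intro j k
    simp only [leviMat_ellipsoidFn]
    exact hasFDerivAt_const _ _

/-- The full contraction of the Gauss equation. The two metric products pair the indices crosswise
and parallel, giving `tr 1` and `(tr 1)²`. -/
theorem sum_curvature_eq_trace {κ : Type*} [Fintype κ] [DecidableEq κ] (g h H : Matrix κ κ ℂ)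
    (hg : g * h = 1) (ν : ℂ) :
    ∑ α, ∑ β, ∑ γ, ∑ σ, g β α * g σ γ *
      ((h α σ * h γ β + h γ σ * h α β - H γ α * star (H σ β)) / ν) =
      (Fintype.card κ + Fintype.card κ ^ 2 - (gᵀ * Hᴴ * g * H).trace) / ν := by
  have e1 : ∑ α, ∑ β, ∑ γ, ∑ σ, g β α * g σ γ * (h α σ * h γ β) = Fintype.card κ := by
    have : ∑ α, ∑ β, ∑ γ, ∑ σ, g β α * g σ γ * (h α σ * h γ β) = (g * (h * (g * h))).trace := by
      simp only [trace, diag_apply, mul_apply, Finset.mul_sum]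
      rw [Finset.sum_comm]
      refine Finset.sum_congr rfl fun β _ => Finset.sum_congr rfl fun α _ => ?_
      rw [Finset.sum_comm]
      exact Finset.sum_congr rfl fun σ _ => Finset.sum_congr rfl fun γ _ => by ring
    rw [this, hg, Matrix.mul_one, hg, trace_one]
  have e2 : ∑ α, ∑ β, ∑ γ, ∑ σ, g β α * g σ γ * (h γ σ * h α β) = (Fintype.card κ : ℂ) ^ 2 := by
    have ht : ∑ α, ∑ β, g β α * h α β = Fintype.card κ := by
      rw [Finset.sum_comm, ← trace_one, ← hg]
      rfl
    rw [sq, ← ht]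
    simp only [Finset.sum_mul]
    refine Finset.sum_congr rfl fun α _ => Finset.sum_congr rfl fun β _ => ?_
    simp only [Finset.mul_sum]
    exact Finset.sum_congr rfl fun γ _ => Finset.sum_congr rfl fun σ _ => by ring
  have e3 : ∑ α, ∑ β, ∑ γ, ∑ σ, g β α * g σ γ * (H γ α * star (H σ β)) =
      (gᵀ * Hᴴ * g * H).trace := by
    simp only [Matrix.mul_assoc, trace, diag_apply, mul_apply, Finset.mul_sum,
      conjTranspose_apply, transpose_apply]
    refine Finset.sum_congr rfl fun α _ => Finset.sum_congr rfl fun β _ => ?_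
    rw [Finset.sum_comm]
    exact Finset.sum_congr rfl fun σ _ => Finset.sum_congr rfl fun γ _ => by ring
  rw [← e3, ← e2]
  nth_rw 1 [← e1]
  simp only [← Finset.sum_add_distrib, ← Finset.sum_sub_distrib, Finset.sum_div]
  refine Finset.sum_congr rfl fun α _ => Finset.sum_congr rfl fun β _ =>
    Finset.sum_congr rfl fun γ _ => Finset.sum_congr rfl fun σ _ => by ring

theorem scalarCurv_ellipsoidFn_pos (hn : 1 ≤ n) (ha : ∀ j, 0 < a j) (hb : ∀ j, 0 < b j) {p : Cn n}
    (hp : ellipsoidFn a b p = 0) {Z : Fin n → Cn n → Cn n} (hZ : IsFrameAt (ellipsoidFn a b) Z p) :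
    0 < scalarCurv (ellipsoidFn a b) Z p := by
  have hρ := (contDiff_ellipsoidFn a b).contDiffAt (x := p)
  have hflat := isLeviFlatAt_ellipsoidFn ha hb hp
  have hν := normalNorm_pos (hρ.differentiableAt (by simp)) hflat.fderiv_ne
    (posDef_leviMat_ellipsoidFn ha hb p)
  set P : Matrix (Fin n) (Fin (n + 1)) ℂ := Matrix.of fun α => Z α p with hP
  set H : Matrix (Fin n) (Fin n) ℂ :=
    fun γ α => hessForm (ellipsoidFn a b) p (Z γ p) (Z α p) with hHdef
  have hh : frameMat (ellipsoidFn a b) Z p =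
      P * diagonal (fun j => (((a j + b j) / 2 : ℝ) : ℂ)) * Pᴴ := by
    rw [← leviMat_ellipsoidFn a b p]
    ext α β
    rw [frameMat, levi_eq]
    rfl
  have hH : H = P * diagonal (fun j => (((a j - b j) / 2 : ℝ) : ℂ)) * Pᵀ := by
    rw [← rhoDD_ellipsoidFn a b p]
    ext α β
    simp only [hHdef]
    rw [hessForm, dotProduct_mulVec]
    rfl
  have hpos : (frameMat (ellipsoidFn a b) Z p).PosDef := by
    rw [hh, ← leviMat_ellipsoidFn a b p]
    exact (posDef_leviMat_ellipsoidFn ha hb p).mul_mul_conjTranspose_same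
      (vecMul_injective_iff.2 hZ.2)
  -- The bound `s_j² ≤ l_j²` holds because `l_j² - s_j² = a_j b_j > 0`.
  have htr := trace_hess_le P (fun j => (a j + b j) / 2) (fun j => (a j - b j) / 2)
    (fun j => half_pos (add_pos (ha j) (hb j)))
    (fun j => by nlinarith [mul_pos (ha j) (hb j)]) hh hH hpos
  have hR (α β γ σ : Fin n) := curvTensor_eq hρ hp
    (Filter.Eventually.of_forall fun z hz => isLeviFlatAt_ellipsoidFn ha hb hz) (hZ.1 α)
    ((hZ.1 β).2.self_of_nhds hp) (hZ.1 γ) (hZ.1 σ)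
  have hsum := sum_curvature_eq_trace (frameMat (ellipsoidFn a b) Z p)⁻¹ _ H
    (nonsing_inv_mul _ hpos.det_pos.ne'.isUnit) (normalNorm (ellipsoidFn a b) p)
  rw [scalarCurv]
  simp only [hR]
  change 0 < (∑ α, ∑ β, ∑ γ, ∑ σ, (frameMat (ellipsoidFn a b) Z p)⁻¹ β α *
    (frameMat (ellipsoidFn a b) Z p)⁻¹ σ γ * ((frameMat (ellipsoidFn a b) Z p α σ *
      frameMat (ellipsoidFn a b) Z p γ β + frameMat (ellipsoidFn a b) Z p γ σ *
      frameMat (ellipsoidFn a b) Z p α β - H γ α * star (H σ β)) /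
      normalNorm (ellipsoidFn a b) p)).re
  rw [hsum, Fintype.card_fin]
  rw [Fintype.card_fin] at htr
  have hnum : 0 < (n : ℂ) + n ^ 2 -
      ((frameMat (ellipsoidFn a b) Z p)⁻¹ᵀ * Hᴴ * (frameMat (ellipsoidFn a b) Z p)⁻¹ * H).trace := by
    -- After `|H|² ≤ n` the numerator is at least `n²`, which is positive as `n ≥ 1`.
    have h1 : (0 : ℂ) < (n : ℂ) ^ 2 := by
      have : 0 < n ^ 2 := by positivity
      exact_mod_cast this
    have h2 := add_pos_of_nonneg_of_pos (sub_nonneg.2 htr) h1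
    convert h2 using 1
    ring
  exact (Complex.pos_iff.1 (div_pos hnum hν)).1

end Ellipsoid

end Pseudohermitian

theorem corollary1p3 :
    (∀ (n : ℕ) (U : Set (Cn n)) (ρ : Cn n → ℝ) (a : Matrix (Fin (n + 1)) (Fin (n + 1)) ℂ),
      IsOpen U → ContDiffOn ℝ ∞ ρ U →
      (∀ p ∈ zeroSet U ρ, fderiv ℝ ρ p ≠ 0) →
      a.PosDef →
      (∀ p ∈ zeroSet U ρ, ∀ j k, (fun z => leviMat ρ z j k - a j k) =o[𝓝 p] ρ) →
      IsCConvex U ρ →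
      ∀ p ∈ zeroSet U ρ, ∀ Z : Cn n → Cn n, IsSectionAt ρ Z p → Z p ≠ 0 →
        1 / 2 * (normSqD a ρ p)⁻¹ ≤ holSecCurv ρ Z p) ∧
    (∀ (n : ℕ) (a b : Fin (n + 1) → ℝ), 1 ≤ n → (∀ j, 0 < a j) → (∀ j, 0 < b j) →
      ∀ p ∈ zeroSet Set.univ (ellipsoidFn a b), ∀ Z : Fin n → Cn n → Cn n,
        IsFrameAt (ellipsoidFn a b) Z p → 0 < scalarCurv (ellipsoidFn a b) Z p) := by
  refine ⟨fun n U ρ a hU hρ hd ha hL hconv p hp Z hZ hZ0 => ?_,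
    fun n a b hn ha hb p hp Z hZ => scalarCurv_ellipsoidFn_pos hn ha hb hp.2 hZ⟩
  have hLa {q : Cn n} (hq : q ∈ zeroSet U ρ) : leviMat ρ q = a :=
    leviMat_eq_of_isLittleO hq.2 (hL q hq)
  have hs {q : Cn n} (hq : q ∈ U) : ContDiffAt ℝ ∞ ρ q := hρ.contDiffAt (hU.mem_nhds hq)
  rw [normSqD_eq (hLa hp)]
  refine le_holSecCurv (hs hp.1) hp.2 ?_ ((hLa hp).symm ▸ ha) (hconv p hp) hZ hZ0
  -- The curvature takes two derivatives, so stationarity is needed at all nearby points of `M`; the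
  -- hypotheses provide it at each of them.
  filter_upwards [hU.mem_nhds hp.1] with q hqU hq0
  have hq : q ∈ zeroSet U ρ := ⟨hqU, hq0⟩
  exact isLeviFlatAt_of_posDef (contDiffAt_infty.1 (hs hqU) 1)
    (contDiffAt_infty.1 (contDiffAt_rhoD (hs hqU)) 1) hq0 (hd q hq) ((hLa hq).symm ▸ ha)
    (hasFDerivAt_leviMat_of_isLittleO ((hs hqU).differentiableAt (by simp)) hq0 (hL q hq))
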